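/- For a finite simple graph $G$ on $n$ vertices let $d$, $\delta$ and $\Delta$ denote its average, minimum and maximum degree, and let $\lambda_1\ge\lambda_2\ge\dots\ge\lambda_n$ be the eigenvalues of its adjacency matrix, listed with multiplicity. Let $(G_k)_{k\ge 0}$ be a sequence of finite simple graphs, where $G_k$ has $n=n_k$ vertices and $n_k\to\infty$ as $k\to\infty$, and let $\lambda=\lambda(k)$ be real numbers such that every nontrivial eigenvalue of $G_k$ satisfies $|\lambda_i|\le\lambda$ $(2\le i\le n)$. Suppose that, with all parameters taken for $G_k$, 1. there is a constant $R>0$, independent of $k$, with $\Delta-\delta\le R\lambda$ for all $k$; 2. $\log^2 n=o(d/\lambda)$ as $k\to\infty$; 3. $\log n=o\bigl(\log d\cdot\log(d/\lambda)\bigr)$ as $k\to\infty$. Then the number of Hamilton cycles in $G_k$ (counted as subgraphs, without starting vertex or orientation) is $$n!\left(\frac dn\right)^n(1+o(1))^n\qquad(k\to\infty);$$ that is, there are real numbers $\varepsilon_k\to 0$ such that for all sufficiently large $k$ this number equals $n!\,(d/n)^n(1+\varepsilon_k)^n$. -/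

import Mathlib

open Filter Asymptotics
open scoped Topology Nat

namespace SimpleGraph

/-- The average degree `(∑ v, deg v) / |V|`. -/
noncomputable def avgDegree {V : Type*} [Fintype V] (G : SimpleGraph V)
    [DecidableRel G.Adj] : ℝ :=
  (∑ v, (G.degree v : ℝ)) / Fintype.card V

/-- With the adjacency eigenvalues `λ₁ ≥ λ₂ ≥ ⋯ ≥ λₙ` listed with multiplicity, all of
`λ₂, …, λₙ` are at most `lam` in absolute value. (`eigenvalues₀` is the decreasing list,
indexed from `0`.) -/
def NontrivialEigenvaluesLE {V : Type*} [Fintype V] [DecidableEq V] (G : SimpleGraph V)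
    [DecidableRel G.Adj] (lam : ℝ) : Prop :=
  ∀ i : Fin (Fintype.card V), (i : ℕ) ≠ 0 →
    |(G.isHermitian_adjMatrix ℝ).eigenvalues₀ i| ≤ lam

/-- The number of Hamilton cycles of `G`, as subgraphs (no starting vertex, no orientation). -/
noncomputable def numHamiltonCycles {V : Type*} [DecidableEq V] (G : SimpleGraph V) : ℕ :=
  Set.ncard {H : G.Subgraph | ∃ (v : V) (p : G.Walk v v),
    p.IsHamiltonianCycle ∧ p.toSubgraph = H}

end SimpleGraph

/-!
Since all degrees are within `O(λ)` of `d`, the constant vector is almost an eigenvector, and the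
spectral gap makes the number of edges between any two sets `S` and `T` of vertices equal to
`d |S| |T| / n` up to an error `O(λ √(|S| |T|))`. Everything else follows from this mixing property.

Linear forests are counted by adding their arcs one at a time: if `m` vertices have no outgoing and
`m` have no incoming arc yet, there are at most `d m (m + c) / n` admissible arcs, where
`c = O(λ n / d)`, and about `d m² / n` of them as long as `m` is large compared with `c`. Carried to
the end, this bounds the number of Hamilton paths, hence of Hamilton cycles, from above.

For the lower bound, add arcs until `o(n / log² n)` paths are left. String these together to an
ordering of the vertices, in which few consecutive pairs are not adjacent. By mixing, the set of
endpoints that Pósa rotations reach inside a well connected stretch of the ordering doubles with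
every rotation, so `O(log n)` rotations make the first and the last vertex adjacent. Closing up the
ordering to a cycle and cutting it at a nonadjacent pair removes that pair. The repairs change
`o(n / log n)` pairs altogether, so only `exp (o(n))` orderings lead to the same Hamilton cycle.
-/

namespace HamiltonCycleCount

section Lists

open List

variable {V : Type*}

/-- `J` is a contiguous block of `l`, possibly traversed backwards. This is how a stretch of a
Hamilton path survives a sequence of rotations. -/
def Intact (J l : List V) : Prop := J <:+: l ∨ J.reverse <:+: l

lemma Intact.reverse {J l : List V} (h : Intact J l) : Intact J l.reverse := by
  rcases h with h | h
  · exact Or.inr (reverse_infix.2 h)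
  · exact Or.inl (by simpa using reverse_infix.2 h)

lemma Intact.append_left {J A : List V} (h : Intact J A) (B : List V) : Intact J (A ++ B) :=
  h.imp infix_append_of_infix_left infix_append_of_infix_left

lemma Intact.append_right {J B : List V} (h : Intact J B) (A : List V) : Intact J (A ++ B) :=
  h.imp infix_append_of_infix_right infix_append_of_infix_right

lemma Intact.mem {J l : List V} (h : Intact J l) {x : V} (hx : x ∈ J) : x ∈ l := by
  rcases h with h | h
  · exact h.subset hx
  · exact h.subset (by simpa using hx)

variable [DecidableEq V]

/-- The arcs of a list, seen as a directed path: its ordered pairs of consecutive entries. -/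
def steps (l : List V) : Finset (V × V) := (l.zip l.tail).toFinset

/-- The edges of a list, seen as an undirected path: its unordered pairs of consecutive entries. -/
def pathEdges (l : List V) : Finset (Sym2 V) := (steps l).image Sym2.mk.uncurry

@[simp] lemma steps_nil : steps ([] : List V) = ∅ := rfl

@[simp] lemma steps_cons_cons (a b : V) (l : List V) :
    steps (a :: b :: l) = insert (a, b) (steps (b :: l)) := by
  simp [steps]

lemma mem_steps_cons {e : V × V} {a : V} {l : List V} :
    e ∈ steps (a :: l) ↔ e ∈ steps l ∨ ∃ y ∈ l.head?, e = (a, y) := by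
  cases l with
  | nil => simp [steps]
  | cons b l => simp [or_comm]

lemma mem_steps_append {e : V × V} {A B : List V} :
    e ∈ steps (A ++ B) ↔ e ∈ steps A ∨ e ∈ steps B ∨
      ∃ x ∈ A.getLast?, ∃ y ∈ B.head?, e = (x, y) := by
  induction A with
  | nil => simp
  | cons a A ih =>
    cases A with
    | nil => rw [cons_append, nil_append, mem_steps_cons]; simp [steps]
    | cons b A =>
      rw [cons_append, mem_steps_cons, ih, mem_steps_cons (l := b :: A), getLast?_cons_cons]
      simp only [cons_append, head?_cons, Option.mem_some_iff, exists_eq_left', or_assoc]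
      grind

lemma mk_mem_steps_iff {u v : V} {l : List V} :
    (u, v) ∈ steps l ↔ ∃ A B, l = A ++ u :: v :: B := by
  constructor
  · intro h
    induction l with
    | nil => simp at h
    | cons a l ih =>
      rcases mem_steps_cons.1 h with h | ⟨y, hy, he⟩
      · obtain ⟨A, B, rfl⟩ := ih h
        exact ⟨a :: A, B, rfl⟩
      · obtain ⟨rfl, rfl⟩ := Prod.mk.inj he
        obtain ⟨B, rfl⟩ := head?_eq_some_iff.1 hy
        exact ⟨[], B, rfl⟩
  · rintro ⟨A, B, rfl⟩
    simp [mem_steps_append]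

lemma card_steps {l : List V} (hl : l.Nodup) : (steps l).card = l.length - 1 := by
  have h : (l.zip l.tail).Nodup := by
    refine Nodup.of_map Prod.snd ?_
    rw [map_snd_zip (by simp)]
    exact hl.sublist (tail_sublist l)
  simp [steps, toFinset_card_of_nodup h]

@[simp] lemma pathEdges_nil : pathEdges ([] : List V) = ∅ := rfl

lemma mem_pathEdges {e : Sym2 V} {l : List V} :
    e ∈ pathEdges l ↔ ∃ u v, (u, v) ∈ steps l ∧ e = s(u, v) := by
  simp [pathEdges, eq_comm]

lemma mem_pathEdges_append {e : Sym2 V} {A B : List V} :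
    e ∈ pathEdges (A ++ B) ↔ e ∈ pathEdges A ∨ e ∈ pathEdges B ∨
      ∃ x ∈ A.getLast?, ∃ y ∈ B.head?, e = s(x, y) := by
  simp only [mem_pathEdges, mem_steps_append, Prod.mk.injEq]
  grind

lemma mem_pathEdges_cons {e : Sym2 V} {a : V} {l : List V} :
    e ∈ pathEdges (a :: l) ↔ e ∈ pathEdges l ∨ ∃ y ∈ l.head?, e = s(a, y) := by
  simp only [mem_pathEdges, mem_steps_cons, Prod.mk.injEq]
  grind

@[simp] lemma pathEdges_reverse (l : List V) : pathEdges l.reverse = pathEdges l := by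
  induction l with
  | nil => rfl
  | cons a l ih =>
    ext e
    rw [reverse_cons, mem_pathEdges_append, mem_pathEdges_cons, ih]
    simp [mem_pathEdges_cons, Sym2.eq_swap]

lemma exists_append_of_mem_pathEdges {l : List V} {e : Sym2 V} (he : e ∈ pathEdges l) :
    ∃ A B : List V, l = A ++ B ∧ ∃ x ∈ A.getLast?, ∃ y ∈ B.head?, e = s(x, y) := by
  obtain ⟨u, v, h, rfl⟩ := mem_pathEdges.1 he
  obtain ⟨A, B, rfl⟩ := mk_mem_steps_iff.1 h
  exact ⟨A ++ [u], v :: B, by simp, u, by simp, v, by simp, rfl⟩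

lemma mem_of_mem_pathEdges {l : List V} {e : Sym2 V} (he : e ∈ pathEdges l) {x : V}
    (hx : x ∈ e) : x ∈ l := by
  obtain ⟨u, v, h, rfl⟩ := mem_pathEdges.1 he
  obtain ⟨A, B, rfl⟩ := mk_mem_steps_iff.1 h
  rcases Sym2.mem_iff.1 hx with rfl | rfl <;> simp

lemma card_pathEdges {l : List V} (hl : l.Nodup) : (pathEdges l).card = l.length - 1 := by
  induction l with
  | nil => rfl
  | cons a l ih =>
    cases l with
    | nil => rfl
    | cons b l =>
      obtain ⟨ha, hl⟩ := nodup_cons.1 hl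
      rw [pathEdges, steps_cons_cons, Finset.image_insert, ← pathEdges,
        Finset.card_insert_of_notMem, ih hl]
      · rfl
      · exact fun h => ha (mem_of_mem_pathEdges h (Sym2.mem_mk_left _ _))

lemma mem_pathEdges_iff_of_nodup {A B : List V} {z w : V} (h : (A ++ z :: B).Nodup) :
    s(z, w) ∈ pathEdges (A ++ z :: B) ↔ A.getLast? = some w ∨ B.head? = some w := by
  have hA : z ∉ A := fun hz => by grind
  have hB : z ∉ B := fun hz => by grind
  have notMem {l : List V} (hl : z ∉ l) : s(z, w) ∉ pathEdges l := fun he =>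
    hl (mem_of_mem_pathEdges he (Sym2.mem_mk_left _ _))
  simp only [mem_pathEdges_append, mem_pathEdges_cons, notMem hA, notMem hB, false_or, head?_cons,
    Option.mem_some_iff, exists_eq_left', Sym2.congr_right]
  simp only [Sym2.eq_swap (a := z), Sym2.congr_left, Option.mem_def, exists_eq_right']
  exact or_comm

lemma card_filter_mem_pathEdges_le_two [Fintype V] {l : List V} (hl : l.Nodup) (z : V) :
    (Finset.univ.filter fun w => s(z, w) ∈ pathEdges l).card ≤ 2 := by
  by_cases hz : z ∈ l
  · obtain ⟨A, B, rfl⟩ := append_of_mem hz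
    calc _ ≤ (A.getLast?.toFinset ∪ B.head?.toFinset).card := by
            apply Finset.card_le_card
            intro w hw
            simpa [mem_pathEdges_iff_of_nodup hl] using hw
      _ ≤ A.getLast?.toFinset.card + B.head?.toFinset.card := Finset.card_union_le _ _
      _ ≤ 1 + 1 := by
            gcongr
            · cases A.getLast? <;> simp
            · cases B.head? <;> simp
  · rw [Finset.filter_false_of_mem fun w _ h =>
      hz (mem_of_mem_pathEdges h (Sym2.mem_mk_left _ _))]
    simp

lemma mem_pathEdges_tail_iff {e : Sym2 V} {a : V} {l : List V} (hl : (a :: l).Nodup) :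
    e ∈ pathEdges l ↔ e ∈ pathEdges (a :: l) ∧ a ∉ e := by
  rw [mem_pathEdges_cons]
  constructor
  · exact fun h => ⟨Or.inl h, fun ha => (nodup_cons.1 hl).1 (mem_of_mem_pathEdges h ha)⟩
  · rintro ⟨h | ⟨y, -, rfl⟩, ha⟩
    · exact h
    · simp at ha

lemma eq_of_head_eq_of_pathEdges_eq {l l' : List V} (hl : l.Nodup) (hl' : l'.Nodup)
    (hh : l.head? = l'.head?) (he : pathEdges l = pathEdges l') : l = l' := by
  induction l generalizing l' with
  | nil => cases l' <;> simp_all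
  | cons a l ih =>
    obtain ⟨l', rfl⟩ := head?_eq_some_iff.1 hh.symm
    have head_eq : l.head? = l'.head? := by
      ext w
      have h := mem_pathEdges_iff_of_nodup (A := []) (w := w) hl
      have h' := mem_pathEdges_iff_of_nodup (A := []) (w := w) hl'
      simp only [nil_append, getLast?_nil, reduceCtorEq, false_or] at h h'
      rw [← h, ← h', he]
    congr 1
    refine ih hl.of_cons hl'.of_cons head_eq ?_
    ext e
    rw [mem_pathEdges_tail_iff hl, mem_pathEdges_tail_iff hl', he]

lemma mem_pathEdges_of_infix {J l : List V} (hJ : J <:+: l) (hl : l.Nodup) {w z : V} (hw : w ∈ J)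
    (hh : J.head? ≠ some w) (ht : J.getLast? ≠ some w) (h : s(w, z) ∈ pathEdges l) :
    s(w, z) ∈ pathEdges J := by
  obtain ⟨A, B, rfl⟩ := hJ
  obtain ⟨C, D, rfl⟩ := append_of_mem hw
  have hC : C ≠ [] := by rintro rfl; simp at hh
  have hD : D ≠ [] := by rintro rfl; simp at ht
  have hCD : (C ++ w :: D).Nodup := hl.sublist (infix_append A _ B).sublist
  have hassoc : A ++ (C ++ w :: D) ++ B = (A ++ C) ++ w :: (D ++ B) := by simp
  rw [hassoc] at hl h
  rw [mem_pathEdges_iff_of_nodup hl] at h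
  rwa [mem_pathEdges_iff_of_nodup hCD, ← getLast?_append_of_ne_nil A hC,
    ← head?_append_of_ne_nil D hD]

lemma infix_append_cases {J A B : List V} (h : J <:+: A ++ B) :
    J <:+: A ∨ J <:+: B ∨ ∃ x ∈ A.getLast?, ∃ y ∈ B.head?, s(x, y) ∈ pathEdges J := by
  rw [infix_append_iff_ne_nil] at h
  rcases h with h | h | ⟨l₁, l₂, hl₁, hl₂, rfl, ⟨t, rfl⟩, ⟨t', rfl⟩⟩
  · exact Or.inl h
  · exact Or.inr (Or.inl h)
  · have hx := getLast?_eq_getLast_of_ne_nil hl₁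
    have hy := head?_eq_some_head hl₂
    refine Or.inr (Or.inr ⟨l₁.getLast hl₁, ?_, l₂.head hl₂, ?_, ?_⟩)
    · rwa [getLast?_append_of_ne_nil _ hl₁]
    · rwa [head?_append_of_ne_nil _ hl₂]
    · exact mem_pathEdges_append.2 (Or.inr (Or.inr ⟨_, hx, _, hy, rfl⟩))

lemma Intact.append_cases {J A B : List V} (h : Intact J (A ++ B)) :
    Intact J A ∨ Intact J B ∨ ∃ x ∈ A.getLast?, ∃ y ∈ B.head?, s(x, y) ∈ pathEdges J := by
  rcases h with h | h
  · rcases infix_append_cases h with h | h | h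
    exacts [Or.inl (Or.inl h), Or.inr (Or.inl (Or.inl h)), Or.inr (Or.inr h)]
  · rcases infix_append_cases h with h | h | h
    exacts [Or.inl (Or.inr h), Or.inr (Or.inl (Or.inr h)),
      Or.inr (Or.inr (by rwa [pathEdges_reverse] at h))]

lemma Intact.mem_pathEdges {J l : List V} (h : Intact J l) (hl : l.Nodup) {w z : V} (hw : w ∈ J)
    (hh : J.head? ≠ some w) (ht : J.getLast? ≠ some w) (he : s(w, z) ∈ pathEdges l) :
    s(w, z) ∈ pathEdges J := by
  rcases h with h | h
  · exact mem_pathEdges_of_infix h hl hw hh ht he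
  · rw [← pathEdges_reverse]
    exact mem_pathEdges_of_infix h hl (by simpa using hw) (by simpa using ht) (by simpa using hh) he

omit [DecidableEq V]

lemma Intact.exists_append_of_infix {J K l : List V} (hJ : J <:+: l) (hK : Intact K l)
    (hJ₀ : J ≠ []) (hJK : J.Disjoint K) :
    ∃ A B, l = A ++ B ∧ (Intact J A ∧ Intact K B ∨ Intact K A ∧ Intact J B) := by
  classical
  obtain ⟨A, B, rfl⟩ := hJ
  have hJJ : Intact J J := Or.inl infix_rfl
  rcases hK.append_cases with h | h | ⟨x, hx, y, -, hxy⟩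
  · rcases h.append_cases with h | h | ⟨x, -, y, hy, hxy⟩
    · exact ⟨A, J ++ B, by simp, Or.inr ⟨h, hJJ.append_left _⟩⟩
    · obtain rfl : K = [] := eq_nil_iff_forall_not_mem.2 fun x hx => hJK (h.mem hx) hx
      exact ⟨A ++ J, B, rfl, Or.inl ⟨hJJ.append_right _, Or.inl nil_infix⟩⟩
    · exact absurd (mem_of_mem_pathEdges hxy (Sym2.mem_mk_right _ _)) (hJK (mem_of_mem_head? hy))
  · exact ⟨A ++ J, B, rfl, Or.inl ⟨hJJ.append_right _, h⟩⟩
  · rw [getLast?_append_of_ne_nil _ hJ₀] at hx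
    exact absurd (mem_of_mem_pathEdges hxy (Sym2.mem_mk_left _ _)) (hJK (mem_of_mem_getLast? hx))

lemma Intact.exists_append {J K l : List V} (hJ : Intact J l) (hK : Intact K l)
    (hJ₀ : J ≠ []) (hJK : J.Disjoint K) :
    ∃ A B, l = A ++ B ∧ (Intact J A ∧ Intact K B ∨ Intact K A ∧ Intact J B) := by
  rcases hJ with hJ | hJ
  · exact hK.exists_append_of_infix hJ hJ₀ hJK
  · obtain ⟨A, B, rfl, h⟩ := hK.exists_append_of_infix hJ (by simpa) (by simpa using hJK)
    refine ⟨A, B, rfl, ?_⟩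
    simpa [Intact, or_comm] using h

end Lists

open Finset

section Rerouting

variable {V : Type*} [DecidableEq V] {G : SimpleGraph V} {s t : ℕ} {l l' l'' A B : List V}

/-- `l'` is a reordering of `l` in which at most `t` path edges are new, all new ones being edges
of `G`. -/
structure ModifiedBy (G : SimpleGraph V) (t : ℕ) (l l' : List V) : Prop where
  perm : l'.Perm l
  card_sdiff : #(pathEdges l' \ pathEdges l) ≤ t
  adj : ∀ e ∈ pathEdges l', e ∈ pathEdges l ∨ e ∈ G.edgeSet

/-- `l'` arises from `l` by at most `t` modifications, and every block of `l` survives unless it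
contains one of at most `t` destroyed edges. -/
structure Rerouted (G : SimpleGraph V) (t : ℕ) (l l' : List V) : Prop extends
    ModifiedBy G t l l' where
  intact : ∃ D : Finset (Sym2 V), #D ≤ t ∧ ∀ J, Intact J l → Disjoint D (pathEdges J) → Intact J l'

lemma ModifiedBy.trans (h : ModifiedBy G s l l') (h' : ModifiedBy G t l' l'') :
    ModifiedBy G (s + t) l l'' where
  perm := h'.perm.trans h.perm
  card_sdiff := calc
    #(pathEdges l'' \ pathEdges l)
      ≤ #((pathEdges l' \ pathEdges l) ∪ (pathEdges l'' \ pathEdges l')) :=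
        card_le_card fun e he => by simp only [Finset.mem_sdiff, mem_union] at he ⊢; tauto
    _ ≤ s + t := (card_union_le _ _).trans (add_le_add h.card_sdiff h'.card_sdiff)
  adj e he := (h'.adj e he).elim (h.adj e) Or.inr

lemma ModifiedBy.reverse (h : ModifiedBy G t l l') : ModifiedBy G t l.reverse l'.reverse where
  perm := (List.reverse_perm _).trans (h.perm.trans (List.reverse_perm _).symm)
  card_sdiff := by simpa using h.card_sdiff
  adj := by simpa using h.adj

lemma ModifiedBy.append {A' B' : List V} (hA : ModifiedBy G s A A') (hB : ModifiedBy G t B B')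
    (hlast : A'.getLast? = A.getLast?) (hhead : B'.head? = B.head?) :
    ModifiedBy G (s + t) (A ++ B) (A' ++ B') where
  perm := hA.perm.append hB.perm
  card_sdiff := calc
    #(pathEdges (A' ++ B') \ pathEdges (A ++ B))
      ≤ #((pathEdges A' \ pathEdges A) ∪ (pathEdges B' \ pathEdges B)) := by
        refine card_le_card fun e he => ?_
        simp only [Finset.mem_sdiff, mem_union, mem_pathEdges_append, hlast, hhead] at he ⊢
        grind
    _ ≤ s + t := (card_union_le _ _).trans (add_le_add hA.card_sdiff hB.card_sdiff)
  adj e he := by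
    rw [mem_pathEdges_append, hlast, hhead] at he
    rw [mem_pathEdges_append]
    have := hA.adj e
    have := hB.adj e
    grind

lemma Rerouted.refl (l : List V) : Rerouted G 0 l l :=
  ⟨⟨.refl _, by simp, fun _ h => Or.inl h⟩, ∅, by simp, fun _ h _ => h⟩

lemma Rerouted.trans (h : Rerouted G s l l') (h' : Rerouted G t l' l'') :
    Rerouted G (s + t) l l'' := by
  obtain ⟨D, hD, hD'⟩ := h.intact
  obtain ⟨E, hE, hE'⟩ := h'.intact
  refine ⟨h.toModifiedBy.trans h'.toModifiedBy, D ∪ E,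
    (card_union_le _ _).trans (add_le_add hD hE), fun J hJ hd => ?_⟩
  rw [disjoint_union_left] at hd
  exact hE' J (hD' J hJ hd.1) hd.2

lemma Rerouted.reverse (h : Rerouted G t l l') : Rerouted G t l.reverse l'.reverse := by
  obtain ⟨D, hD, hD'⟩ := h.intact
  refine ⟨h.toModifiedBy.reverse, D, hD, fun J hJ hd => (hD' J ?_ hd).reverse⟩
  simpa using hJ.reverse

lemma Rerouted.mono (h : Rerouted G s l l') (hst : s ≤ t) : Rerouted G t l l' := by
  obtain ⟨D, hD, hD'⟩ := h.intact
  exact ⟨⟨h.perm, h.card_sdiff.trans hst, h.adj⟩, D, hD.trans hst, hD'⟩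

lemma mem_pathEdges_append_reverse {w y : V} (hw : w ∈ A.getLast?) (hy : y ∈ B.getLast?)
    {e : Sym2 V} (he : e ∈ pathEdges (A ++ B.reverse)) : e ∈ pathEdges (A ++ B) ∨ e = s(w, y) := by
  rw [mem_pathEdges_append, pathEdges_reverse, List.head?_reverse] at he
  rw [mem_pathEdges_append]
  rcases he with he | he | ⟨x, hx, z, hz, rfl⟩
  · tauto
  · tauto
  · rw [Option.mem_unique hx hw, Option.mem_unique hz hy]
    exact Or.inr rfl

lemma Rerouted.append_reverse {w y : V} (hw : w ∈ A.getLast?) (hy : y ∈ B.getLast?)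
    (hwy : G.Adj w y) : Rerouted G 1 (A ++ B) (A ++ B.reverse) := by
  have mem_of_mem {e} := mem_pathEdges_append_reverse (e := e) hw hy
  have hB : B ≠ [] := by rintro rfl; simp at hy
  refine ⟨⟨(List.reverse_perm B).append_left A, ?_, ?_⟩, {s(w, B.head hB)}, by simp, ?_⟩
  · refine (card_le_card fun e he => ?_).trans_eq (card_singleton s(w, y))
    rw [Finset.mem_sdiff] at he
    exact mem_singleton.2 ((mem_of_mem he.1).resolve_left he.2)
  · exact fun e he => (mem_of_mem he).imp_right (by rintro rfl; exact hwy)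
  · intro J hJ hd
    rcases hJ.append_cases with h | h | ⟨x, hx, z, hz, hxz⟩
    · exact h.append_left _
    · exact h.reverse.append_right _
    · rw [List.head?_eq_some_head hB, Option.mem_some_iff] at hz
      rw [Option.mem_unique hx hw, ← hz] at hxz
      exact absurd hxz (disjoint_singleton_left.1 hd)

lemma exists_rerouted_one (hl : l.Nodup) {v w : V} (hv : l.getLast? = some v) (hw : w ∈ l)
    (hwv : G.Adj w v) :
    ∃ z l', s(w, z) ∈ pathEdges l ∧ Rerouted G 1 l l' ∧ l'.head? = l.head? ∧
      l'.getLast? = some z ∧ ∀ e ∈ pathEdges l', e ∈ pathEdges l ∨ e = s(w, v) := by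
  obtain ⟨A, B, rfl⟩ := List.append_of_mem hw
  cases B with
  | nil =>
    simp only [List.getLast?_append, List.getLast?_singleton, Option.some_or,
      Option.some.injEq] at hv
    exact absurd hv hwv.ne
  | cons z B =>
    have hwz : s(w, z) ∈ pathEdges (A ++ w :: z :: B) := by
      simp [mem_pathEdges_iff_of_nodup hl]
    rw [List.append_cons] at hv hwz ⊢
    rw [List.getLast?_append_of_ne_nil _ (by simp)] at hv
    refine ⟨z, (A ++ [w]) ++ (z :: B).reverse, hwz, .append_reverse (by simp) hv hwv, ?_, ?_,
      fun e => mem_pathEdges_append_reverse (by simp) hv⟩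
    · cases A <;> simp
    · rw [List.getLast?_append_of_ne_nil _ (by simp)]
      simp

end Rerouting

section Enclosed

variable {V : Type*} [DecidableEq V] {l J : List V} {X Y : Finset V} {w : V}

/-- The entries of the list `l` all of whose neighbours along `l` lie in `X`. A rotation at such an
entry produces a new endpoint in `X`. -/
def enclosed (l : List V) (X : Finset V) : Finset V :=
  l.toFinset.filter fun w => ∀ z ∈ l, s(w, z) ∈ pathEdges l → z ∈ X

/-- The enclosed entries of `J` other than its two ends. Their neighbours do not change when `J` is
regarded as a block of a longer list. -/
def inner (J : List V) (X : Finset V) : Finset V :=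
  (enclosed J X).filter fun w => J.head? ≠ some w ∧ J.getLast? ≠ some w

lemma mem_enclosed : w ∈ enclosed l X ↔ w ∈ l ∧ ∀ z, s(w, z) ∈ pathEdges l → z ∈ X := by
  have mem_of_mem {z} (h : s(w, z) ∈ pathEdges l) : z ∈ l :=
    mem_of_mem_pathEdges h (Sym2.mem_mk_right w z)
  simp only [enclosed, mem_filter, List.mem_toFinset]
  exact and_congr_right fun _ => ⟨fun h z hz => h z (mem_of_mem hz) hz, fun h z _ => h z⟩

lemma enclosed_mono (l : List V) : Monotone (enclosed l) := fun _ _ h _ hw => by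
  rw [mem_enclosed] at hw ⊢
  exact ⟨hw.1, fun z hz => h (hw.2 z hz)⟩

lemma inner_mono (J : List V) : Monotone (inner J) := fun _ _ h =>
  filter_subset_filter _ (enclosed_mono J h)

lemma inner_subset_enclosed_of_intact (h : Intact J l) (hl : l.Nodup) (X : Finset V) :
    inner J X ⊆ enclosed l X := by
  intro w hw
  rw [inner, mem_filter, mem_enclosed] at hw
  rw [mem_enclosed]
  exact ⟨h.mem hw.1.1, fun z hz => hw.1.2 z (h.mem_pathEdges hl hw.1.1 hw.2.1 hw.2.2 hz)⟩

variable [Fintype V]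

lemma card_sdiff_enclosed_compl_le (hl : l.Nodup) (Z : Finset V) :
    #(l.toFinset \ enclosed l Zᶜ) ≤ 2 * #Z := by
  rw [mul_comm]
  refine (card_le_card fun w hw => ?_).trans (card_biUnion_le_card_mul Z
    (fun z => univ.filter fun w => s(z, w) ∈ pathEdges l) 2
    fun z _ => card_filter_mem_pathEdges_le_two hl z)
  simp only [Finset.mem_sdiff, List.mem_toFinset, mem_enclosed, mem_compl, not_and, not_forall,
    not_not] at hw
  obtain ⟨z, hwz, hz⟩ := hw.2 hw.1
  exact mem_biUnion.2 ⟨z, hz, by simpa [Sym2.eq_swap] using hwz⟩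

lemma length_le_card_inner_compl (hJ : J.Nodup) (Z : Finset V) :
    J.length ≤ #(inner J Zᶜ) + 2 * #Z + 2 := by
  have hsub : J.toFinset ⊆ inner J Zᶜ ∪ (J.toFinset \ enclosed J Zᶜ) ∪
      (J.head?.toFinset ∪ J.getLast?.toFinset) := by
    intro w hw
    simp only [mem_union, inner, mem_filter, Finset.mem_sdiff, Option.mem_toFinset, Option.mem_def,
      hw]
    tauto
  calc J.length = #J.toFinset := (List.toFinset_card_of_nodup hJ).symm
    _ ≤ _ := card_le_card hsub
    _ ≤ #(inner J Zᶜ) + 2 * #Z + (1 + 1) := by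
      refine (card_union_le _ _).trans (add_le_add ((card_union_le _ _).trans
        (add_le_add_right (card_sdiff_enclosed_compl_le hJ Z) _)) ((card_union_le _ _).trans ?_))
      gcongr
      · cases J.head? <;> simp
      · cases J.getLast? <;> simp
    _ = #(inner J Zᶜ) + 2 * #Z + 2 := by ring

end Enclosed

section Mixing

variable {V : Type*} {G : SimpleGraph V} [DecidableRel G.Adj] {d μ q : ℝ} {S T U X : Finset V}

/-- Every vertex of `X` has at least `q` neighbours in `U`. -/
def MinDegreeInto (G : SimpleGraph V) [DecidableRel G.Adj] (q : ℝ) (X U : Finset V) : Prop :=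
  ∀ v ∈ X, q ≤ #(U.filter (G.Adj v))

lemma card_interedges_eq_sum (S T : Finset V) :
    #(G.interedges S T) = ∑ v ∈ S, #(T.filter (G.Adj v)) := by
  simp only [SimpleGraph.interedges, Rel.interedges, card_filter, sum_product]

lemma MinDegreeInto.mono {U' : Finset V} (h : MinDegreeInto G q X U) (hU : U ⊆ U') :
    MinDegreeInto G q X U' :=
  fun v hv => (h v hv).trans (Nat.cast_le.2 (card_le_card (filter_subset_filter _ hU)))

lemma MinDegreeInto.mul_card_le_card_interedges (hX : MinDegreeInto G q X U) (hS : S ⊆ X)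
    (hT : ∀ v ∈ S, ∀ w ∈ U, G.Adj v w → w ∈ T) : q * #S ≤ #(G.interedges S T) := by
  rw [card_interedges_eq_sum, mul_comm, ← nsmul_eq_mul, Nat.cast_sum]
  refine card_nsmul_le_sum _ _ _ fun v hv => (hX v (hS hv)).trans ?_
  refine Nat.cast_le.2 (card_le_card fun w hw => ?_)
  rw [mem_filter] at hw ⊢
  exact ⟨hT v hv w hw.1 hw.2, hw.2⟩

variable [Fintype V]

/-- The conclusion of the expander mixing lemma, with density `d / |V|` and error `μ`: the only
consequence of the eigenvalue hypothesis that the counting uses. -/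
def Mixing (G : SimpleGraph V) [DecidableRel G.Adj] (d μ : ℝ) : Prop :=
  ∀ S T : Finset V, |(#(G.interedges S T) : ℝ) - d * #S * #T / Fintype.card V| ≤
    μ * √(#S * #T)

lemma Mixing.le (h : Mixing G d μ) (S T : Finset V) :
    (#(G.interedges S T) : ℝ) ≤ d * #S * #T / Fintype.card V + μ * √(#S * #T) :=
  sub_le_iff_le_add'.1 (abs_le.1 (h S T)).2

lemma Mixing.ge (h : Mixing G d μ) (S T : Finset V) :
    d * #S * #T / Fintype.card V - μ * √(#S * #T) ≤ #(G.interedges S T) := by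
  linarith [(abs_le.1 (h S T)).1]

lemma Mixing.card_mul_card_mul_sq_le (h : Mixing G d μ) (hd : 0 ≤ d)
    (hST : (#(G.interedges S T) : ℝ) ≤ d * #S * #T / (2 * Fintype.card V)) :
    #S * #T * d ^ 2 ≤ 4 * μ ^ 2 * (Fintype.card V : ℝ) ^ 2 := by
  rcases S.eq_empty_or_nonempty with rfl | ⟨v, -⟩
  · rw [card_empty, Nat.cast_zero, zero_mul, zero_mul]
    positivity
  have hn : (0 : ℝ) < Fintype.card V := by exact_mod_cast Fintype.card_pos_iff.2 ⟨v⟩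
  set n : ℝ := (Fintype.card V : ℝ)
  set p : ℝ := #S * #T with hp
  have hp₀ : 0 ≤ p := by positivity
  have hlin : d * p ≤ 2 * μ * n * √p := by
    have hge := h.ge S T
    have hhalf : d * #S * #T / n = 2 * (d * #S * #T / (2 * n)) := by field_simp
    have : d * #S * #T / (2 * n) ≤ μ * √p := by linarith
    rw [div_le_iff₀ (by positivity)] at this
    linarith
  rcases hp₀.eq_or_lt with h₀ | hpos
  · rw [← h₀, zero_mul]
    positivity
  have hsq : p * (p * d ^ 2) ≤ p * (4 * μ ^ 2 * n ^ 2) := calc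
    p * (p * d ^ 2) = (d * p) ^ 2 := by ring
    _ ≤ (2 * μ * n * √p) ^ 2 := by gcongr
    _ = p * (4 * μ ^ 2 * n ^ 2) := by rw [mul_pow, Real.sq_sqrt hp₀]; ring
  exact le_of_mul_le_mul_left hsq hpos

lemma Mixing.exists_adj (h : Mixing G d μ) (hd : 0 ≤ d) (hμ : 0 ≤ μ) {s : ℝ} (hS : s ≤ #S)
    (hT : s ≤ #T) (hs : 2 * μ * Fintype.card V < d * s) : ∃ x ∈ S, ∃ y ∈ T, G.Adj x y := by
  by_contra! hcon
  have hempty : G.interedges S T = ∅ := by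
    refine eq_empty_of_forall_notMem fun ⟨x, y⟩ hxy => ?_
    rw [SimpleGraph.mem_interedges_iff] at hxy
    exact hcon x hxy.1 y hxy.2.1 hxy.2.2
  have hsmall := h.card_mul_card_mul_sq_le (S := S) (T := T) hd
    (by rw [hempty, card_empty, Nat.cast_zero]; positivity)
  have hs₀ : 0 < s := pos_of_mul_pos_right (lt_of_le_of_lt (by positivity) hs) hd
  have hlarge : (d * s) ^ 2 ≤ #S * #T * d ^ 2 := calc
    (d * s) ^ 2 = s * s * d ^ 2 := by ring
    _ ≤ #S * #T * d ^ 2 := by gcongr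
  have : (2 * μ * Fintype.card V) ^ 2 < (d * s) ^ 2 := by gcongr
  linarith [show (2 * μ * Fintype.card V) ^ 2 = 4 * μ ^ 2 * (Fintype.card V : ℝ) ^ 2 by ring]

lemma Mixing.seven_mul_card_le (h : Mixing G d μ) (hμ : 0 ≤ μ) (hd : 0 < d) (hq : 6 * μ ≤ q)
    (hX : MinDegreeInto G q X U) (hS : S ⊆ X) (hcard : 14 * d * #S ≤ q * Fintype.card V) :
    7 * #S ≤ #(U.filter fun w => ∃ v ∈ S, G.Adj v w) := by
  rcases S.eq_empty_or_nonempty with rfl | ⟨v, hv⟩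
  · simp
  by_contra! hlt
  set W := U.filter fun w => ∃ v ∈ S, G.Adj v w
  have hS₀ : (0 : ℝ) < #S := by exact_mod_cast card_pos.2 ⟨v, hv⟩
  have hn : (0 : ℝ) < Fintype.card V := by exact_mod_cast Fintype.card_pos_iff.2 ⟨v⟩
  have hW : (#W : ℝ) < 7 * #S := by exact_mod_cast hlt
  have hmany : q * #S ≤ #(G.interedges S W) :=
    hX.mul_card_le_card_interedges hS fun v hv w hw hvw => mem_filter.2 ⟨hw, v, hv, hvw⟩
  have hmain : d * #S * #W / Fintype.card V < q / 2 * #S := by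
    rw [div_lt_iff₀ hn]
    calc d * #S * #W < d * #S * (7 * #S) := mul_lt_mul_of_pos_left hW (by positivity)
      _ = 14 * d * #S * (#S / 2) := by ring
      _ ≤ q * Fintype.card V * (#S / 2) := by gcongr
      _ = q / 2 * #S * Fintype.card V := by ring
  have herr : μ * √(#S * #W) ≤ q / 2 * #S := by
    have hsqrt : √((#S : ℝ) * #W) ≤ 3 * #S := by
      rw [Real.sqrt_le_left (by positivity)]
      nlinarith
    calc μ * √(#S * #W) ≤ μ * (3 * #S) := by gcongr
      _ = 6 * μ * (#S / 2) := by ring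
      _ ≤ q * (#S / 2) := by gcongr
      _ = q / 2 * #S := by ring
  linarith [h.le S W]

end Mixing

section Rotations

variable {V : Type*} [DecidableEq V] {G : SimpleGraph V} {S S' : Finset V} {t t' : ℕ}
  {l l' : List V} {v w : V}

lemma card_le_two_mul_card_image [Finite V] {W : Finset V} {f : V → V} (hl : l.Nodup)
    (hf : ∀ w ∈ W, s(w, f w) ∈ pathEdges l) : #W ≤ 2 * #(W.image f) := by
  cases nonempty_fintype V
  refine card_le_mul_card_image W 2 fun z _ => ?_
  refine (card_le_card fun w hw => ?_).trans (card_filter_mem_pathEdges_le_two hl z)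
  obtain ⟨hwW, rfl⟩ := mem_filter.1 hw
  exact mem_filter.2 ⟨mem_univ w, Sym2.eq_swap ▸ hf w hwW⟩

variable [Fintype V]

/-- Away from `S` and its neighbours along `l`, the list `l'` has no new path edges. -/
def UnchangedOff (S : Finset V) (l l' : List V) : Prop :=
  ∀ w ∈ enclosed l Sᶜ, w ∉ S → ∀ z, s(w, z) ∈ pathEdges l' → s(w, z) ∈ pathEdges l

/-- The endpoint `v` is reached from `l` by at most `t` rotations which fix the first entry of `l`
and whose successive endpoints lie in `S`. -/
def RotatesTo (G : SimpleGraph V) (S : Finset V) (t : ℕ) (l : List V) (v : V) : Prop :=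
  ∃ l', Rerouted G t l l' ∧ l'.head? = l.head? ∧ l'.getLast? = some v ∧ UnchangedOff S l l'

lemma UnchangedOff.mono (h : UnchangedOff S l l') (hS : S ⊆ S') : UnchangedOff S' l l' :=
  fun w hw hwS => h w (enclosed_mono l (compl_subset_compl.2 hS) hw) fun hw' => hwS (hS hw')

lemma RotatesTo.mono (h : RotatesTo G S t l v) (hS : S ⊆ S') (ht : t ≤ t') :
    RotatesTo G S' t' l v :=
  let ⟨l', hr, hhead, hlast, hun⟩ := h
  ⟨l', hr.mono ht, hhead, hlast, hun.mono hS⟩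

lemma RotatesTo.step (h : RotatesTo G S t l v) (hl : l.Nodup) (hv : v ∈ S)
    (hw : w ∈ enclosed l Sᶜ) (hwS : w ∉ S) (hwv : G.Adj w v) :
    ∃ z, s(w, z) ∈ pathEdges l ∧ RotatesTo G (insert z S) (t + 1) l z := by
  obtain ⟨l', hr, hhead, hlast, hun⟩ := h
  have hwl' : w ∈ l' := hr.perm.mem_iff.2 (mem_enclosed.1 hw).1
  obtain ⟨z, l'', hz, hr', hhead', hlast', hedges⟩ :=
    exists_rerouted_one (hr.perm.nodup_iff.2 hl) hlast hwl' hwv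
  have hwz : s(w, z) ∈ pathEdges l := hun w hw hwS z hz
  refine ⟨z, hwz, l'', hr.trans hr', hhead'.trans hhead, hlast', fun x hx hxS y hxy => ?_⟩
  rcases hedges _ hxy with hold | hnew
  · exact hun.mono (subset_insert z S) x hx hxS y hold
  rcases Sym2.eq_iff.1 hnew with ⟨rfl, rfl⟩ | ⟨rfl, rfl⟩
  · exact absurd (mem_insert_self z S) (mem_compl.1 ((mem_enclosed.1 hx).2 z hwz))
  · exact absurd (mem_insert_of_mem hv) hxS

variable [DecidableRel G.Adj] {X : Finset V} {d μ q : ℝ}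

lemma Mixing.exists_double (h : Mixing G d μ) (hμ : 0 ≤ μ) (hd : 0 < d) (hq : 6 * μ ≤ q)
    (hl : l.Nodup) (hX : MinDegreeInto G q X (enclosed l X)) (hSX : S ⊆ X)
    (hS : ∀ v ∈ S, RotatesTo G S t l v) (hcard : 14 * d * #S ≤ q * Fintype.card V) :
    ∃ S' ⊆ X, 2 * #S ≤ #S' ∧ ∀ v ∈ S', RotatesTo G S' (t + 1) l v := by
  have hseven := h.seven_mul_card_le hμ hd hq hX hSX hcard
  set W := (enclosed l X).filter fun w => ∃ v ∈ S, G.Adj v w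
  set W' := (W ∩ enclosed l Sᶜ) \ S
  have hW' : 4 * #S ≤ #W' := by
    have hsub : W ⊆ W' ∪ S ∪ (l.toFinset \ enclosed l Sᶜ) := fun w hw => by
      have hwl : w ∈ l := (mem_enclosed.1 (mem_filter.1 hw).1).1
      simp only [W', mem_union, Finset.mem_sdiff, mem_inter, List.mem_toFinset]
      tauto
    have := card_le_card hsub
    have := card_union_le (W' ∪ S) (l.toFinset \ enclosed l Sᶜ)
    have := card_union_le W' S
    have := card_sdiff_enclosed_compl_le hl S
    omega
  have hstep : ∀ w ∈ W', ∃ z, s(w, z) ∈ pathEdges l ∧ RotatesTo G (insert z S) (t + 1) l z := by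
    intro w hw
    obtain ⟨hwW, hwS⟩ := Finset.mem_sdiff.1 hw
    obtain ⟨v, hvS, hvw⟩ := (mem_filter.1 (mem_inter.1 hwW).1).2
    exact (hS v hvS).step hl hvS (mem_inter.1 hwW).2 hwS hvw.symm
  choose! f hf hrot using hstep
  refine ⟨S ∪ W'.image f, union_subset hSX fun z hz => ?_, ?_, fun v hv => ?_⟩
  · obtain ⟨w, hw, rfl⟩ := mem_image.1 hz
    have hwW : w ∈ W := (mem_inter.1 (Finset.mem_sdiff.1 hw).1).1
    exact (mem_enclosed.1 (mem_filter.1 hwW).1).2 _ (hf w hw)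
  · have := card_le_two_mul_card_image hl hf
    have := card_le_card (subset_union_right (s₁ := S) (s₂ := W'.image f))
    omega
  · rcases mem_union.1 hv with hvS | hv
    · exact (hS v hvS).mono subset_union_left (Nat.le_succ t)
    · obtain ⟨w, hw, rfl⟩ := mem_image.1 hv
      exact (hrot w hw).mono (insert_subset (mem_union_right S hv) subset_union_left) le_rfl

lemma Mixing.exists_iterated_double (h : Mixing G d μ) (hμ : 0 ≤ μ) (hd : 0 < d)
    (hq : 6 * μ ≤ q) (hl : l.Nodup) (hX : MinDegreeInto G q X (enclosed l X))
    (hv : l.getLast? = some v) (hvX : v ∈ X) (t : ℕ) :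
    ∃ S ⊆ X, (q * Fintype.card V ≤ 14 * d * #S ∨ 2 ^ t ≤ #S) ∧
      ∀ w ∈ S, RotatesTo G S t l w := by
  induction t with
  | zero =>
    refine ⟨{v}, singleton_subset_iff.2 hvX, Or.inr (by simp), fun w hw => ?_⟩
    obtain rfl := mem_singleton.1 hw
    exact ⟨l, Rerouted.refl l, rfl, hv, fun _ _ _ _ hz => hz⟩
  | succ t ih =>
    obtain ⟨S, hSX, hS, hrot⟩ := ih
    by_cases hbig : q * Fintype.card V ≤ 14 * d * #S
    · exact ⟨S, hSX, Or.inl hbig, fun w hw => (hrot w hw).mono subset_rfl (Nat.le_succ t)⟩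
    · obtain ⟨S', hS'X, hdouble, hrot'⟩ :=
        h.exists_double hμ hd hq hl hX hSX hrot (not_le.1 hbig).le
      have := hS.resolve_left hbig
      exact ⟨S', hS'X, Or.inr (by rw [pow_succ]; omega), hrot'⟩

lemma Mixing.exists_endpoints (h : Mixing G d μ) (hμ : 0 ≤ μ) (hd : 0 < d) (hq : 6 * μ ≤ q)
    (hqd : q ≤ d) {T : ℕ} (hT : Fintype.card V ≤ 2 ^ T) (hl : l.Nodup)
    (hX : MinDegreeInto G q X (enclosed l X)) (hv : l.getLast? = some v) (hvX : v ∈ X) :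
    ∃ S : Finset V, q * Fintype.card V ≤ 14 * d * #S ∧
      ∀ w ∈ S, ∃ l', Rerouted G T l l' ∧ l'.head? = l.head? ∧ l'.getLast? = some w := by
  obtain ⟨S, -, hS, hrot⟩ := h.exists_iterated_double hμ hd hq hl hX hv hvX T
  refine ⟨S, hS.elim id fun hpow => ?_, fun w hw => ?_⟩
  · have hn : (Fintype.card V : ℝ) ≤ #S := by exact_mod_cast hT.trans hpow
    calc q * Fintype.card V ≤ d * #S := by gcongr
      _ ≤ 14 * (d * #S) := le_mul_of_one_le_left (by positivity) (by norm_num)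
      _ = 14 * d * #S := by ring
  · obtain ⟨l', hr, hhead, hlast, -⟩ := hrot w hw
    exact ⟨l', hr, hhead, hlast⟩

end Rotations

section Cores

variable {V : Type*} [DecidableEq V] [Fintype V] {G : SimpleGraph V} [DecidableRel G.Adj]
  {d μ q : ℝ}

lemma exists_maximal_sparse {U : Finset V → Finset V} (hU : Antitone U) {z₀ : ℝ} (hz₀ : 0 ≤ z₀) :
    ∃ Z, #Z ≤ z₀ + 1 ∧ #(G.interedges Z (U Z)) ≤ q * #Z ∧
      (#Z ≤ z₀ → MinDegreeInto G q Zᶜ (U Z)) := by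
  set F : Finset (Finset V) :=
    univ.filter fun Z => #Z ≤ z₀ + 1 ∧ #(G.interedges Z (U Z)) ≤ q * #Z with hF
  have hempty : ∅ ∈ F := by
    simp only [hF, mem_filter, mem_univ, card_interedges_eq_sum, sum_empty, card_empty,
      Nat.cast_zero, mul_zero, le_refl, true_and, and_true]
    linarith
  obtain ⟨Z, hZ, hmax⟩ := F.exists_max_image card ⟨∅, hempty⟩
  simp only [hF, mem_filter, mem_univ, true_and] at hZ hmax
  refine ⟨Z, hZ.1, hZ.2, fun hle v hv => ?_⟩
  rw [mem_compl] at hv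
  by_contra! hlt
  have hsparse : (#(G.interedges (insert v Z) (U (insert v Z))) : ℝ) ≤ q * (#Z + 1) := calc
    (#(G.interedges (insert v Z) (U (insert v Z))) : ℝ)
      ≤ #(G.interedges (insert v Z) (U Z)) := by
        refine Nat.cast_le.2 (card_le_card ?_)
        exact Rel.interedges_mono subset_rfl (hU (subset_insert v Z))
    _ = #((U Z).filter (G.Adj v)) + #(G.interedges Z (U Z)) := by
        rw [card_interedges_eq_sum, card_interedges_eq_sum, sum_insert hv, Nat.cast_add]
    _ ≤ q + q * #Z := add_le_add hlt.le hZ.2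
    _ = q * (#Z + 1) := by ring
  have hcard : #(insert v Z) = #Z + 1 := card_insert_of_notMem hv
  have := hmax (insert v Z) (by rw [hcard]; push_cast; exact ⟨by linarith, hsparse⟩)
  omega

lemma Mixing.exists_core (h : Mixing G d μ) (hd : 0 < d) {J : List V} (hJ : J.Nodup) {z₀ : ℝ}
    (hz₀ : 0 ≤ z₀) (hlen : 4 * z₀ + 8 ≤ J.length)
    (hz₀d : 8 * μ ^ 2 * (Fintype.card V : ℝ) ^ 2 ≤ z₀ * (d ^ 2 * J.length)) :
    ∃ X, #Xᶜ ≤ z₀ ∧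
      MinDegreeInto G (d * J.length / (4 * Fintype.card V)) X (inner J X) := by
  have hlen₀ : (0 : ℝ) < J.length := by linarith
  set q := d * J.length / (4 * Fintype.card V)
  obtain ⟨Z, hZ, hsparse, hcore⟩ := exists_maximal_sparse (G := G) (q := q)
    (U := fun Z => inner J Zᶜ) (fun _ _ hZ => inner_mono J (compl_subset_compl.2 hZ)) hz₀
  suffices hle : #Z ≤ z₀ from ⟨Zᶜ, by rwa [compl_compl], hcore hle⟩
  have hinner : (J.length : ℝ) / 2 ≤ #(inner J Zᶜ) := by
    have : (J.length : ℝ) ≤ #(inner J Zᶜ) + 2 * #Z + 2 := by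
      exact_mod_cast length_le_card_inner_compl hJ Z
    linarith
  have hfew : (#(G.interedges Z (inner J Zᶜ)) : ℝ) ≤
      d * #Z * #(inner J Zᶜ) / (2 * Fintype.card V) := calc
    (#(G.interedges Z (inner J Zᶜ)) : ℝ) ≤ q * #Z := hsparse
    _ = d * #Z * (J.length / 2) / (2 * Fintype.card V) := by simp only [q]; ring
    _ ≤ d * #Z * #(inner J Zᶜ) / (2 * Fintype.card V) := by gcongr
  refine le_of_mul_le_mul_right ?_ (by positivity : 0 < d ^ 2 * (J.length : ℝ))
  calc #Z * (d ^ 2 * J.length) = 2 * (#Z * (J.length / 2) * d ^ 2) := by ring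
    _ ≤ 2 * (#Z * #(inner J Zᶜ) * d ^ 2) := by gcongr
    _ ≤ 2 * (4 * μ ^ 2 * (Fintype.card V : ℝ) ^ 2) :=
      mul_le_mul_of_nonneg_left (h.card_mul_card_mul_sq_le hd.le hfew) zero_le_two
    _ = 8 * μ ^ 2 * (Fintype.card V : ℝ) ^ 2 := by ring
    _ ≤ z₀ * (d ^ 2 * J.length) := hz₀d

end Cores

section Blocks

variable {V : Type*} {l : List V} {b i j : ℕ}

/-- The `i`-th block of `b` consecutive entries of `l`, counting from `0`. -/
def block (l : List V) (b i : ℕ) : List V := (l.drop (i * b)).take b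

lemma block_infix (l : List V) (b i : ℕ) : block l b i <:+: l :=
  (List.take_prefix _ _).isInfix.trans (List.drop_suffix _ _).isInfix

lemma length_block (h : (i + 1) * b ≤ l.length) : (block l b i).length = b := by
  rw [block, List.length_take, List.length_drop]
  rw [add_mul] at h
  omega

lemma block_disjoint_of_lt (hl : l.Nodup) (hij : i < j) :
    (block l b i).Disjoint (block l b j) := by
  have hle : i * b + b ≤ j * b := by
    rw [← Nat.succ_mul]
    exact Nat.mul_le_mul_right b hij
  intro x hx hx'
  rw [block, List.take_drop] at hx
  exact List.disjoint_take_drop hl hle (List.drop_subset _ _ hx) (List.take_subset _ _ hx')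

lemma block_disjoint (hl : l.Nodup) (hij : i ≠ j) : (block l b i).Disjoint (block l b j) :=
  hij.lt_or_gt.elim (block_disjoint_of_lt hl) fun h => (block_disjoint_of_lt hl h).symm

lemma exists_blocks_disjoint [DecidableEq V] (hl : l.Nodup) {M : ℕ} {D : Finset (Sym2 V)}
    (hD : #D + 2 ≤ M) :
    ∃ i < M, ∃ j < M, i ≠ j ∧ Disjoint D (pathEdges (block l b i)) ∧
      Disjoint D (pathEdges (block l b j)) := by
  set bad := (range M).filter fun i => ¬ Disjoint D (pathEdges (block l b i)) with hbad
  have hcard : #bad ≤ #D := by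
    have hex : ∀ i ∈ bad, ∃ e ∈ D, e ∈ pathEdges (block l b i) := fun i hi =>
      not_disjoint_iff.1 (mem_filter.1 hi).2
    refine card_le_card_of_forall_subsingleton _ hex fun e _ i hi j hj => ?_
    by_contra hij
    exact block_disjoint hl hij (mem_of_mem_pathEdges hi.2 e.out_fst_mem)
      (mem_of_mem_pathEdges hj.2 e.out_fst_mem)
  have hgood : 1 < #(range M \ bad) := by
    have := le_card_sdiff bad (range M)
    rw [card_range] at this
    omega
  obtain ⟨i, hi, j, hj, hij⟩ := one_lt_card.1 hgood
  simp only [hbad, Finset.mem_sdiff, mem_filter, Finset.mem_range, not_and, not_not] at hi hj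
  exact ⟨i, hi.1, j, hj.1, hij, hi.2 hi.1, hj.2 hj.1⟩

end Blocks

section Closing

variable {V : Type*} [DecidableEq V] [Fintype V] {G : SimpleGraph V} [DecidableRel G.Adj]
  {d μ q : ℝ} {T : ℕ} {l : List V}

/-- The two ends of the list `l` are adjacent, so that a path along `l` closes up to a cycle. -/
def EndsAdj (G : SimpleGraph V) (l : List V) : Prop :=
  ∃ u ∈ l.head?, ∃ v ∈ l.getLast?, G.Adj u v

omit [DecidableEq V] in
lemma length_eq_card (hl : l.Nodup) (hmem : ∀ v, v ∈ l) : l.length = Fintype.card V := by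
  classical
  rw [← List.toFinset_card_of_nodup hl, ← card_univ]
  exact congrArg card (eq_univ_of_forall fun v => List.mem_toFinset.2 (hmem v))

lemma Mixing.exists_endsAdj_of_append (h : Mixing G d μ) (hμ : 0 ≤ μ) (hd : 0 < d)
    (hq : 28 * μ < q) (hqd : q ≤ d) (hT : Fintype.card V ≤ 2 ^ T) {A B : List V}
    (hAB : (A ++ B).Nodup) {X Y : Finset V} (hX : MinDegreeInto G q X (enclosed A.reverse X))
    (hY : MinDegreeInto G q Y (enclosed B Y)) {x y : V} (hx : A.head? = some x) (hxX : x ∈ X)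
    (hy : B.getLast? = some y) (hyY : y ∈ Y) :
    ∃ l', ModifiedBy G (T + T) (A ++ B) l' ∧ EndsAdj G l' := by
  have hA : A.reverse.Nodup := List.nodup_reverse.2 hAB.of_append_left
  have hn : (0 : ℝ) < Fintype.card V := by exact_mod_cast Fintype.card_pos_iff.2 ⟨x⟩
  obtain ⟨S, hS, hrotA⟩ := h.exists_endpoints hμ hd (by linarith) hqd hT hA hX
    (by rw [List.getLast?_reverse, hx]) hxX
  obtain ⟨S', hS', hrotB⟩ := h.exists_endpoints hμ hd (by linarith) hqd hT hAB.of_append_right hY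
    hy hyY
  obtain ⟨u, hu, v, hv, huv⟩ := h.exists_adj (S := S) (T := S')
    (s := q * Fintype.card V / (14 * d)) hd.le hμ
    (div_le_of_le_mul₀ (by positivity) (by positivity) (by linarith))
    (div_le_of_le_mul₀ (by positivity) (by positivity) (by linarith)) (by
      calc 2 * μ * Fintype.card V < q / 14 * Fintype.card V := by gcongr; linarith
        _ = d * (q * Fintype.card V / (14 * d)) := by field_simp)
  obtain ⟨A', hA', hAhead, hAlast⟩ := hrotA u hu
  obtain ⟨B', hB', hBhead, hBlast⟩ := hrotB v hv
  refine ⟨A'.reverse ++ B', ?_, u, ?_, v, ?_, huv⟩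
  · have hA'' := hA'.toModifiedBy.reverse
    rw [List.reverse_reverse] at hA''
    refine hA''.append hB'.toModifiedBy ?_ hBhead
    rw [List.getLast?_reverse, hAhead, List.head?_reverse]
  · simp [List.head?_append, hAlast]
  · simp [List.getLast?_append, hBlast]

lemma Mixing.exists_endsAdj_of_intact (h : Mixing G d μ) (hμ : 0 ≤ μ) (hd : 0 < d)
    (hq : 28 * μ < q) (hqd : q ≤ d) (hT : Fintype.card V ≤ 2 ^ T) (hl : l.Nodup)
    {J K : List V} (hJ : Intact J l) (hK : Intact K l) (hJ₀ : J ≠ []) (hK₀ : K ≠ [])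
    (hJK : J.Disjoint K) {X Y : Finset V} (hX : MinDegreeInto G q X (inner J X))
    (hY : MinDegreeInto G q Y (inner K Y)) {x y : V} (hx : l.head? = some x) (hxXY : x ∈ X ∩ Y)
    (hy : l.getLast? = some y) (hyXY : y ∈ X ∩ Y) :
    ∃ l', ModifiedBy G (T + T) l l' ∧ EndsAdj G l' := by
  obtain ⟨A, B, rfl, hcase⟩ := hJ.exists_append hK hJ₀ hJK
  wlog hJA : Intact J A ∧ Intact K B generalizing J K X Y
  · rw [inter_comm] at hxXY hyXY
    exact this hK₀ hJ₀ hJK.symm hY hX hxXY hyXY hcase.symm hK hJ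
      (hcase.resolve_left hJA)
  obtain ⟨hJA, hKB⟩ := hJA
  obtain ⟨a, ha⟩ := List.exists_mem_of_ne_nil J hJ₀
  obtain ⟨c, hc⟩ := List.exists_mem_of_ne_nil K hK₀
  rw [List.head?_append_of_ne_nil _ (List.ne_nil_of_mem (hJA.mem ha))] at hx
  rw [List.getLast?_append_of_ne_nil _ (List.ne_nil_of_mem (hKB.mem hc))] at hy
  have hArev : A.reverse.Nodup := List.nodup_reverse.2 hl.of_append_left
  exact h.exists_endsAdj_of_append hμ hd hq hqd hT hl
    (hX.mono (inner_subset_enclosed_of_intact hJA.reverse hArev X))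
    (hY.mono (inner_subset_enclosed_of_intact hKB hl.of_append_right Y))
    hx (mem_inter.1 hxXY).1 hy (mem_inter.1 hyXY).2

lemma Mixing.exists_rerouted_last_mem (h : Mixing G d μ) (hμ : 0 ≤ μ) (hd : 0 < d)
    (hμd : 24 * μ ≤ d) (hdeg : ∀ v, d / 4 ≤ G.degree v) (hT : Fintype.card V ≤ 2 ^ T)
    (hl : l.Nodup) (hmem : ∀ v, v ∈ l) {Y : Finset V} (hY : 56 * #Yᶜ < Fintype.card V) :
    ∃ l', Rerouted G T l l' ∧ l'.head? = l.head? ∧ ∃ a ∈ Y, l'.getLast? = some a := by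
  have hX : MinDegreeInto G (d / 4) univ (enclosed l univ) := fun v _ => by
    refine (hdeg v).trans (Nat.cast_le.2 (card_le_card fun w hw => ?_))
    rw [SimpleGraph.mem_neighborFinset] at hw
    simp [mem_enclosed, hmem, hw]
  have hl₀ : l ≠ [] := by
    obtain ⟨v⟩ := Fintype.card_pos_iff.1 (by omega : 0 < Fintype.card V)
    exact List.ne_nil_of_mem (hmem v)
  obtain ⟨S, hS, hrot⟩ := h.exists_endpoints hμ hd (by linarith) (by linarith) hT hl hX
    (List.getLast?_eq_getLast_of_ne_nil hl₀) (mem_univ _)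
  have hcard : Fintype.card V ≤ 56 * #S := by
    have : d * Fintype.card V ≤ d * (56 * #S) := by linarith
    exact_mod_cast le_of_mul_le_mul_left this hd
  obtain ⟨a, haS, haY⟩ : ∃ a ∈ S, a ∉ Yᶜ := exists_mem_notMem_of_card_lt_card (by omega)
  obtain ⟨l', hr, hhead, hlast⟩ := hrot a haS
  exact ⟨l', hr, hhead, a, by simpa using haY, hlast⟩

lemma Mixing.exists_rerouted_ends_mem (h : Mixing G d μ) (hμ : 0 ≤ μ) (hd : 0 < d)
    (hμd : 24 * μ ≤ d) (hdeg : ∀ v, d / 4 ≤ G.degree v) (hT : Fintype.card V ≤ 2 ^ T)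
    (hl : l.Nodup) (hmem : ∀ v, v ∈ l) {Y : Finset V} (hY : 56 * #Yᶜ < Fintype.card V) :
    ∃ l', Rerouted G (T + T) l l' ∧ (∃ c ∈ Y, l'.head? = some c) ∧
      ∃ a ∈ Y, l'.getLast? = some a := by
  obtain ⟨l₁, hl₁, -, a, ha, hl₁a⟩ := h.exists_rerouted_last_mem hμ hd hμd hdeg hT hl hmem hY
  obtain ⟨l₂, hl₂, hl₂a, c, hc, hl₂c⟩ := h.exists_rerouted_last_mem hμ hd hμd hdeg hT
    (List.nodup_reverse.2 (hl₁.perm.nodup_iff.2 hl))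
    (fun v => List.mem_reverse.2 (hl₁.perm.mem_iff.2 (hmem v))) hY
  refine ⟨l₂.reverse, ?_, ⟨c, hc, by rw [List.head?_reverse, hl₂c]⟩, a, ha, ?_⟩
  · have hl₂' := hl₂.reverse
    rw [List.reverse_reverse] at hl₂'
    exact hl₁.trans hl₂'
  · rw [List.getLast?_reverse, hl₂a, List.head?_reverse, hl₁a]

lemma Mixing.exists_core_block (h : Mixing G d μ) (hμ : 0 ≤ μ) (hd : 0 < d) {M b : ℕ} (hM : 2 ≤ M)
    (hb : 9 ≤ b) (hdb : 57 * M * μ * Fintype.card V ≤ d * b) {J : List V} (hJ : J.Nodup)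
    (hJb : J.length = b) :
    ∃ X, 57 * M * #Xᶜ ≤ b ∧ MinDegreeInto G (d * b / (4 * Fintype.card V)) X (inner J X) := by
  subst hJb
  have hM₂ : (2 : ℝ) ≤ M := by exact_mod_cast hM
  have hb₉ : (9 : ℝ) ≤ J.length := by exact_mod_cast hb
  have hlen : 4 * ((J.length : ℝ) / (57 * M)) + 8 ≤ J.length := by
    have : (J.length : ℝ) / (57 * M) ≤ J.length / (57 * 2) := by gcongr
    linarith
  have hsq : 8 * μ ^ 2 * (Fintype.card V : ℝ) ^ 2 ≤
      J.length / (57 * M) * (d ^ 2 * J.length) := by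
    rw [div_mul_eq_mul_div, le_div_iff₀ (by positivity)]
    calc 8 * μ ^ 2 * (Fintype.card V : ℝ) ^ 2 * (57 * M)
        ≤ 57 * M * μ ^ 2 * (Fintype.card V : ℝ) ^ 2 * (57 * M) := by gcongr; linarith
      _ = (57 * M * μ * Fintype.card V) ^ 2 := by ring
      _ ≤ (d * J.length) ^ 2 := by gcongr
      _ = J.length * (d ^ 2 * J.length) := by ring
  obtain ⟨X, hXc, hX⟩ := h.exists_core hd hJ (by positivity) hlen hsq
  refine ⟨X, ?_, hX⟩
  rw [le_div_iff₀ (by positivity), mul_comm] at hXc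
  exact_mod_cast hXc

lemma card_compl_compl_biUnion_compl_le {M b : ℕ} (hM : 0 < M) {X : ℕ → Finset V}
    (hX : ∀ i < M, 57 * M * #(X i)ᶜ ≤ b) :
    57 * #((range M).biUnion fun i => (X i)ᶜ)ᶜᶜ ≤ b := by
  rw [compl_compl]
  refine le_of_mul_le_mul_left ?_ hM
  calc M * (57 * #((range M).biUnion fun i => (X i)ᶜ))
      ≤ M * (57 * ∑ i ∈ range M, #(X i)ᶜ) := by gcongr; exact card_biUnion_le
    _ = ∑ i ∈ range M, 57 * M * #(X i)ᶜ := by rw [← mul_sum]; ring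
    _ ≤ ∑ _i ∈ range M, b := sum_le_sum fun i hi => hX i (Finset.mem_range.1 hi)
    _ = M * b := by rw [sum_const, card_range, smul_eq_mul]

lemma Mixing.exists_endsAdj (h : Mixing G d μ) (hμ : 0 < μ) (hd : 0 < d) {b M : ℕ}
    (hT : Fintype.card V ≤ 2 ^ T) (hM : 2 * T + 2 ≤ M) (hb : 9 ≤ b) (hbn : M * b ≤ Fintype.card V)
    (hdb : 57 * M * μ * Fintype.card V ≤ d * b) (hdeg : ∀ v, d / 4 ≤ G.degree v) (hl : l.Nodup)
    (hmem : ∀ v, v ∈ l) : ∃ l', ModifiedBy G (4 * T) l l' ∧ EndsAdj G l' := by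
  have hM₂ : 2 ≤ M := le_trans (by omega) hM
  have hlength : ∀ i < M, (block l b i).length = b := fun i hi => length_block <| by
    rw [length_eq_card hl hmem]
    exact (Nat.mul_le_mul_right b hi).trans hbn
  have hblock₀ : ∀ i < M, block l b i ≠ [] := fun i hi =>
    List.ne_nil_of_length_pos (by rw [hlength i hi]; omega)
  choose! X hXc hX using fun i (hi : i < M) => h.exists_core_block hμ.le hd hM₂ hb hdb
    ((block_infix l b i).sublist.nodup hl) (hlength i hi)
  set Y := ((range M).biUnion fun i => (X i)ᶜ)ᶜ with hY
  have hYX : ∀ i < M, Y ⊆ X i := fun i hi => by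
    rw [hY, ← Finset.compl_subset_compl, compl_compl]
    exact subset_biUnion_of_mem (fun i => (X i)ᶜ) (Finset.mem_range.2 hi)
  have hYc : 57 * #Yᶜ ≤ b := card_compl_compl_biUnion_compl_le (by omega) hXc
  have hbn' : b ≤ Fintype.card V := (Nat.le_mul_of_pos_left b (by omega)).trans hbn
  have hn₀ : (0 : ℝ) < Fintype.card V := by exact_mod_cast (by omega : 0 < Fintype.card V)
  have hq : 28 * μ < d * b / (4 * Fintype.card V) := by
    rw [lt_div_iff₀ (by positivity)]
    calc 28 * μ * (4 * Fintype.card V) < 57 * 2 * μ * Fintype.card V := by nlinarith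
      _ ≤ 57 * M * μ * Fintype.card V := by gcongr; exact_mod_cast hM₂
      _ ≤ d * b := hdb
  have hqd : d * b / (4 * Fintype.card V) ≤ d / 4 := by
    rw [div_le_div_iff₀ (by positivity) four_pos]
    calc d * b * 4 ≤ d * Fintype.card V * 4 := by gcongr
      _ = d * (4 * Fintype.card V) := by ring
  obtain ⟨l₁, hl₁, ⟨c, hc, hl₁c⟩, a, ha, hl₁a⟩ :=
    h.exists_rerouted_ends_mem hμ.le hd (by linarith) hdeg hT hl hmem (Y := Y) (by omega)
  obtain ⟨D, hD, hintact⟩ := hl₁.intact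
  obtain ⟨i, hi, j, hj, hij, hDi, hDj⟩ := exists_blocks_disjoint (b := b) (M := M) hl
    (D := D) (by omega)
  obtain ⟨l₂, hl₂, hends⟩ := h.exists_endsAdj_of_intact hμ.le hd hq (by linarith) hT
    (hl₁.perm.nodup_iff.2 hl) (hintact _ (Or.inl (block_infix l b i)) hDi)
    (hintact _ (Or.inl (block_infix l b j)) hDj) (hblock₀ i hi) (hblock₀ j hj)
    (block_disjoint hl hij) (hX i hi) (hX j hj) hl₁c
    (mem_inter.2 ⟨hYX i hi hc, hYX j hj hc⟩) hl₁a (mem_inter.2 ⟨hYX i hi ha, hYX j hj ha⟩)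
  refine ⟨l₂, ?_, hends⟩
  rw [show 4 * T = T + T + (T + T) by ring]
  exact hl₁.toModifiedBy.trans hl₂

end Closing

section Orderings

lemma card_filter_card_le (α : Type*) [Fintype α] (k : ℕ) :
    #{s : Finset α | #s ≤ k} ≤ (Fintype.card α + 1) ^ k := by
  classical
  have hsub : univ.filter (fun s : Finset α => #s ≤ k) ⊆ univ.image fun f : Fin k → Option α =>
      univ.filter fun a => ∃ i, f i = some a := by
    intro s hs
    rw [mem_filter] at hs
    refine mem_image.2 ⟨fun i => s.toList[(i : ℕ)]?, mem_univ _, ?_⟩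
    ext a
    rw [mem_filter, ← mem_toList (s := s), List.mem_iff_getElem?]
    constructor
    · rintro ⟨-, i, hi⟩
      exact ⟨i, hi⟩
    · rintro ⟨i, hi⟩
      have hlt := (List.getElem?_eq_some_iff.1 hi).1
      rw [length_toList] at hlt
      exact ⟨mem_univ _, ⟨i, hlt.trans_le hs.2⟩, hi⟩
  exact (card_le_card hsub).trans (card_image_le.trans_eq (by simp))

variable {V : Type*} [DecidableEq V] [Fintype V] {G : SimpleGraph V} {t u : ℕ} {l l' : List V}

variable (V) in
/-- The orderings of the vertex set, as lists. -/
noncomputable def orderings : Finset (List V) := (univ : Finset V).toList.permutations.toFinset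

lemma mem_orderings : l ∈ orderings V ↔ l.Nodup ∧ ∀ v, v ∈ l := by
  rw [orderings, List.mem_toFinset, List.mem_permutations]
  constructor
  · intro h
    exact ⟨h.nodup_iff.2 (nodup_toList _), fun v => h.mem_iff.2 (by simp)⟩
  · rintro ⟨hl, hmem⟩
    rw [List.perm_ext_iff_of_nodup hl (nodup_toList _)]
    simp [hmem]

lemma ModifiedBy.mem_orderings (h : ModifiedBy G t l l') (hl : l ∈ orderings V) :
    l' ∈ orderings V := by
  rw [HamiltonCycleCount.mem_orderings] at hl ⊢
  exact ⟨h.perm.nodup_iff.2 hl.1, fun v => h.perm.mem_iff.2 (hl.2 v)⟩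

lemma length_of_mem_orderings (hl : l ∈ orderings V) : l.length = Fintype.card V :=
  length_eq_card (mem_orderings.1 hl).1 (mem_orderings.1 hl).2

lemma card_sdiff_comm_of_mem_orderings (hl : l ∈ orderings V) (hl' : l' ∈ orderings V) :
    #(pathEdges l \ pathEdges l') = #(pathEdges l' \ pathEdges l) := by
  refine card_sdiff_comm ?_
  rw [card_pathEdges (mem_orderings.1 hl).1, card_pathEdges (mem_orderings.1 hl').1,
    length_of_mem_orderings hl, length_of_mem_orderings hl']

lemma card_le_of_close {P Q : Finset (List V)} (hP : P ⊆ orderings V) (hQ : Q ⊆ orderings V)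
    {k : ℕ} (h : ∀ l ∈ P, ∃ l' ∈ Q, #(pathEdges l' \ pathEdges l) ≤ k) :
    #P ≤ #Q * ((Fintype.card V + 1) * ((Fintype.card V ^ 2 + 1) ^ k) ^ 2) := by
  choose! f hf hfk using h
  set R : Finset (Finset (Sym2 V)) := {s | #s ≤ k} with hR
  have hRcard : #R ≤ (Fintype.card V ^ 2 + 1) ^ k := by
    refine (card_filter_card_le _ k).trans ?_
    gcongr
    rw [sq, ← Fintype.card_prod]
    exact Fintype.card_le_of_surjective _ Sym2.mk_surjective
  calc #P ≤ #(Q ×ˢ (univ : Finset (Option V)) ×ˢ (R ×ˢ R)) := by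
        refine card_le_card_of_injOn (fun l => (f l, l.head?,
          (pathEdges (f l) \ pathEdges l, pathEdges l \ pathEdges (f l)))) (fun l hl => ?_)
          fun l hl l' hl' heq => ?_
        · simp only [coe_product, Set.mem_prod, mem_coe, mem_univ, true_and, hR, mem_filter]
          refine ⟨hf l hl, hfk l hl, (card_sdiff_comm_of_mem_orderings (hP hl) ?_).trans_le
            (hfk l hl)⟩
          exact hQ (hf l hl)
        · simp only [Prod.mk.injEq] at heq
          obtain ⟨hfl, hhead, hnew, hold⟩ := heq
          refine eq_of_head_eq_of_pathEdges_eq (mem_orderings.1 (hP hl)).1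
            (mem_orderings.1 (hP hl')).1 hhead ?_
          rw [← hfl, Finset.ext_iff] at hnew hold
          ext e
          have := hnew e
          have := hold e
          simp only [Finset.mem_sdiff] at *
          tauto
    _ = #Q * ((Fintype.card V + 1) * (#R * #R)) := by simp [card_product]
    _ ≤ _ := by rw [← sq]; gcongr

end Orderings

section Repair

variable {V : Type*} [DecidableEq V] {G : SimpleGraph V} {t u c : ℕ} {l l' : List V}

lemma ModifiedBy.mono (h : ModifiedBy G t l l') (htu : t ≤ u) : ModifiedBy G u l l' :=
  ⟨h.perm, h.card_sdiff.trans htu, h.adj⟩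

open scoped Classical in
/-- The path edges of `l` that are not edges of `G`. -/
noncomputable def badEdges (G : SimpleGraph V) (l : List V) : Finset (Sym2 V) :=
  (pathEdges l).filter (· ∉ G.edgeSet)

lemma mem_badEdges {e : Sym2 V} : e ∈ badEdges G l ↔ e ∈ pathEdges l ∧ e ∉ G.edgeSet := by
  simp only [badEdges, mem_filter]

lemma ModifiedBy.badEdges_subset (h : ModifiedBy G t l l') : badEdges G l' ⊆ badEdges G l :=
  fun e he => by
    rw [mem_badEdges] at he ⊢
    exact ⟨(h.adj e he.1).resolve_right he.2, he.2⟩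

lemma exists_modifiedBy_badEdges_ssubset (hl : l.Nodup) (hends : EndsAdj G l)
    (hbad : (badEdges G l).Nonempty) :
    ∃ l', ModifiedBy G 1 l l' ∧ badEdges G l' ⊂ badEdges G l := by
  obtain ⟨e, he⟩ := hbad
  obtain ⟨A, B, rfl, x, hx, y, hy, rfl⟩ := exists_append_of_mem_pathEdges (mem_badEdges.1 he).1
  have hxA := List.mem_of_mem_getLast? hx
  have hyB := List.mem_of_mem_head? hy
  have hAB : A.Disjoint B := List.disjoint_of_nodup_append hl
  obtain ⟨u, hu, v, hv, huv⟩ := hends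
  rw [List.head?_append_of_ne_nil _ (List.ne_nil_of_mem hxA)] at hu
  rw [List.getLast?_append_of_ne_nil _ (List.ne_nil_of_mem hyB)] at hv
  have hBA : ∀ f ∈ pathEdges (B ++ A), f = s(u, v) ∨ f ∈ pathEdges (A ++ B) ∧ f ≠ s(x, y) := by
    intro f hf
    rw [mem_pathEdges_append] at hf
    rcases hf with hf | hf | ⟨a, ha, b, hb, rfl⟩
    · refine Or.inr ⟨mem_pathEdges_append.2 (Or.inr (Or.inl hf)), ?_⟩
      rintro rfl
      exact hAB hxA (mem_of_mem_pathEdges hf (Sym2.mem_mk_left _ _))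
    · refine Or.inr ⟨mem_pathEdges_append.2 (Or.inl hf), ?_⟩
      rintro rfl
      exact hAB (mem_of_mem_pathEdges hf (Sym2.mem_mk_right _ _)) hyB
    · rw [Option.mem_unique ha hv, Option.mem_unique hb hu, Sym2.eq_swap]
      exact Or.inl rfl
  have hmod : ModifiedBy G 1 (A ++ B) (B ++ A) :=
    ⟨List.perm_append_comm,
    (card_le_card (t := {s(u, v)}) fun f hf => by grind).trans_eq (card_singleton _), fun f hf => by
      rcases hBA f hf with rfl | h
      · exact Or.inr huv
      · exact Or.inl h.1⟩
  refine ⟨B ++ A, hmod, hmod.badEdges_subset.ssubset_of_ne fun heq => ?_⟩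
  have hxy := mem_badEdges.1 (heq ▸ he)
  rcases hBA _ hxy.1 with h | h
  · exact hxy.2 (h ▸ huv)
  · exact h.2 rfl

variable [Fintype V]

open scoped Classical in
/-- The orderings of the vertex set that run around a Hamilton cycle of `G`. -/
noncomputable def cyclicOrderings (G : SimpleGraph V) : Finset (List V) :=
  (orderings V).filter fun l => badEdges G l = ∅ ∧ EndsAdj G l

lemma mem_cyclicOrderings :
    l ∈ cyclicOrderings G ↔ l ∈ orderings V ∧ badEdges G l = ∅ ∧ EndsAdj G l := by
  simp only [cyclicOrderings, mem_filter]

lemma exists_cyclicOrdering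
    (hclose : ∀ l ∈ orderings V, ∃ l', ModifiedBy G c l l' ∧ EndsAdj G l')
    (hl : l ∈ orderings V) :
    ∃ l' ∈ cyclicOrderings G, ModifiedBy G ((#(badEdges G l) + 1) * (c + 1)) l l' := by
  induction hm : #(badEdges G l) using Nat.strong_induction_on generalizing l with
  | _ m ih =>
    obtain ⟨l₁, h₁, hends⟩ := hclose l hl
    have hl₁ := h₁.mem_orderings hl
    rcases (badEdges G l₁).eq_empty_or_nonempty with hbad | hbad
    · exact ⟨l₁, mem_cyclicOrderings.2 ⟨hl₁, hbad, hends⟩, h₁.mono (by nlinarith)⟩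
    · obtain ⟨l₂, h₂, hlt⟩ :=
        exists_modifiedBy_badEdges_ssubset (mem_orderings.1 hl₁).1 hends hbad
      have hlt : #(badEdges G l₂) < m :=
        hm ▸ card_lt_card (hlt.trans_subset h₁.badEdges_subset)
      obtain ⟨l₃, hl₃, h₃⟩ := ih _ hlt (h₂.mem_orderings hl₁) rfl
      refine ⟨l₃, hl₃, ((h₁.trans h₂).trans h₃).mono ?_⟩
      calc c + 1 + (#(badEdges G l₂) + 1) * (c + 1)
          = (#(badEdges G l₂) + 1 + 1) * (c + 1) := by ring
        _ ≤ (m + 1) * (c + 1) := by gcongr; exact hlt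

end Repair

section LinearForests

variable {V : Type*} [DecidableEq V] {G : SimpleGraph V} {F F' : Finset (V × V)}
  {u v w : V} {l : List V} {s m : ℕ}

lemma injOn_fst_steps (hl : l.Nodup) : Set.InjOn Prod.fst (steps l : Set (V × V)) := by
  have h : ((l.zip l.tail).map Prod.fst).Nodup := by
    rw [List.zip_eq_zip_take_min, List.map_fst_zip (by simp)]
    exact hl.sublist (List.take_sublist _ _)
  simp only [steps, List.coe_toFinset]
  exact List.inj_on_of_nodup_map h

lemma injOn_snd_steps (hl : l.Nodup) : Set.InjOn Prod.snd (steps l : Set (V × V)) := by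
  have h : ((l.zip l.tail).map Prod.snd).Nodup := by
    rw [List.map_snd_zip (by simp)]
    exact hl.sublist (List.tail_sublist l)
  simp only [steps, List.coe_toFinset]
  exact List.inj_on_of_nodup_map h

variable [Fintype V]

/-- A set of arcs of `G` whose components are directed paths; we encode the absence of branching
and of cycles by asking that all arcs be steps of one ordering of the vertices. -/
structure IsLinearForest (G : SimpleGraph V) (F : Finset (V × V)) : Prop where
  adj : ∀ e ∈ F, G.Adj e.1 e.2
  exists_steps : ∃ l ∈ orderings V, F ⊆ steps l

lemma IsLinearForest.subset (h : IsLinearForest G F) (hF : F' ⊆ F) : IsLinearForest G F' :=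
  ⟨fun e he => h.adj e (hF he), h.exists_steps.imp fun _ hl => ⟨hl.1, hF.trans hl.2⟩⟩

lemma IsLinearForest.injOn_fst (h : IsLinearForest G F) : Set.InjOn Prod.fst (F : Set (V × V)) :=
  let ⟨_, hl, hF⟩ := h.exists_steps
  (injOn_fst_steps (mem_orderings.1 hl).1).mono (coe_subset.2 hF)

lemma IsLinearForest.injOn_snd (h : IsLinearForest G F) : Set.InjOn Prod.snd (F : Set (V × V)) :=
  let ⟨_, hl, hF⟩ := h.exists_steps
  (injOn_snd_steps (mem_orderings.1 hl).1).mono (coe_subset.2 hF)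

/-- The vertices without an outgoing arc. -/
def sinks (F : Finset (V × V)) : Finset V := (F.image Prod.fst)ᶜ

/-- The vertices without an incoming arc. -/
def sources (F : Finset (V × V)) : Finset V := (F.image Prod.snd)ᶜ

lemma mem_sinks : u ∈ sinks F ↔ ∀ w, (u, w) ∉ F := by simp [sinks]

lemma mem_sources : u ∈ sources F ↔ ∀ w, (w, u) ∉ F := by simp [sources]

lemma IsLinearForest.card_sinks (h : IsLinearForest G F) : #(sinks F) = Fintype.card V - #F := by
  rw [sinks, card_compl, card_image_of_injOn h.injOn_fst]

lemma IsLinearForest.card_sources (h : IsLinearForest G F) :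
    #(sources F) = Fintype.card V - #F := by
  rw [sources, card_compl, card_image_of_injOn h.injOn_snd]

open scoped Classical in
/-- The arcs that can be added to a linear forest of `G`. -/
noncomputable def extensions (G : SimpleGraph V) (F : Finset (V × V)) : Finset (V × V) :=
  {e | e ∉ F ∧ IsLinearForest G (insert e F)}

lemma mem_extensions {e : V × V} :
    e ∈ extensions G F ↔ e ∉ F ∧ IsLinearForest G (insert e F) := by
  simp [extensions]

lemma extensions_subset_interedges [DecidableRel G.Adj] :
    extensions G F ⊆ G.interedges (sinks F) (sources F) := by
  rintro ⟨u, v⟩ h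
  obtain ⟨hnotMem, hforest⟩ := mem_extensions.1 h
  rw [SimpleGraph.mem_interedges_iff, mem_sinks, mem_sources]
  refine ⟨fun w hw => ?_, fun w hw => ?_, hforest.adj _ (mem_insert_self _ _)⟩
  · have := hforest.injOn_fst (mem_insert_of_mem hw) (mem_insert_self _ _) rfl
    exact hnotMem (this ▸ hw)
  · have := hforest.injOn_snd (mem_insert_of_mem hw) (mem_insert_self _ _) rfl
    exact hnotMem (this ▸ hw)

lemma mem_extensions_of_perm {l' : List V} (hu : u ∈ sinks F) (huv : G.Adj u v)
    (hF : IsLinearForest G F) (hl : l ∈ orderings V) (hperm : l'.Perm l)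
    (hsub : insert (u, v) F ⊆ steps l') : (u, v) ∈ extensions G F := by
  rw [mem_orderings] at hl
  refine mem_extensions.2 ⟨mem_sinks.1 hu v, fun e he => ?_, l', ?_, hsub⟩
  · rcases mem_insert.1 he with rfl | he
    · exact huv
    · exact hF.adj e he
  · exact mem_orderings.2 ⟨hperm.nodup_iff.2 hl.1, fun v => hperm.mem_iff.2 (hl.2 v)⟩

lemma mem_steps_append_of_mem_sources (hv : v ∈ sources F) {e : V × V} (he : e ∈ F)
    {A B : List V} : e ∈ steps (A ++ v :: B) ↔ e ∈ steps A ∨ e ∈ steps (v :: B) := by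
  rw [mem_sources] at hv
  rw [mem_steps_append]
  grind

lemma mem_steps_append_of_mem_sinks (hu : u ∈ sinks F) {e : V × V} (he : e ∈ F)
    {A B : List V} : e ∈ steps (A ++ u :: B) ↔ e ∈ steps (A ++ [u]) ∨ e ∈ steps B := by
  rw [mem_sinks] at hu
  rw [List.append_cons, mem_steps_append]
  grind

lemma IsLinearForest.mem_extensions_of_mem_right (hF : IsLinearForest G F) (hu : u ∈ sinks F)
    (hv : v ∈ sources F) (huv : G.Adj u v) {A B : List V} (hl : A ++ u :: B ∈ orderings V)
    (hFl : F ⊆ steps (A ++ u :: B)) (hvB : v ∈ B) : (u, v) ∈ extensions G F := by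
  obtain ⟨Q, S, rfl⟩ := List.append_of_mem hvB
  refine mem_extensions_of_perm (l' := Q ++ (A ++ [u]) ++ v :: S) hu huv hF hl ?_ ?_
  · grind
  · refine insert_subset (mk_mem_steps_iff.2 ⟨Q ++ A, S, by simp⟩) fun e he => ?_
    have := hFl he
    rw [mem_steps_append_of_mem_sinks hu he, mem_steps_append_of_mem_sources hv he] at this
    rw [mem_steps_append, mem_steps_append]
    tauto

lemma IsLinearForest.mem_extensions_of_mem_left (hF : IsLinearForest G F) (hu : u ∈ sinks F)
    (hv : v ∈ sources F) (hw : w ∈ sources F) (huv : G.Adj u v) {P Q B : List V}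
    (hl : P ++ v :: Q ++ u :: B ∈ orderings V) (hFl : F ⊆ steps (P ++ v :: Q ++ u :: B))
    (hwQ : w ∈ Q) : (u, v) ∈ extensions G F := by
  obtain ⟨Q, S, rfl⟩ := List.append_of_mem hwQ
  refine mem_extensions_of_perm (l' := P ++ (w :: S ++ [u]) ++ (v :: Q) ++ B) hu huv hF hl ?_ ?_
  · grind
  · refine insert_subset (mk_mem_steps_iff.2 ⟨P ++ w :: S, Q ++ B, by simp⟩) fun e he => ?_
    have := hFl he
    rw [mem_steps_append_of_mem_sinks hu he,
      show P ++ v :: (Q ++ w :: S) ++ [u] = P ++ v :: (Q ++ w :: (S ++ [u])) by simp,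
      mem_steps_append_of_mem_sources hv he, ← List.cons_append,
      mem_steps_append_of_mem_sources hw he] at this
    rw [mem_steps_append, mem_steps_append, mem_steps_append (A := P)]
    simp only [List.cons_append] at this ⊢
    tauto

lemma IsLinearForest.mem_extensions_or (hF : IsLinearForest G F) (hu : u ∈ sinks F)
    (hv : v ∈ sources F) (hw : w ∈ sources F) (huv : G.Adj u v) (huw : G.Adj u w) (hvw : v ≠ w) :
    (u, v) ∈ extensions G F ∨ (u, w) ∈ extensions G F := by
  obtain ⟨l, hl, hFl⟩ := hF.exists_steps
  obtain ⟨hnodup, hmem⟩ := mem_orderings.1 hl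
  obtain ⟨A, B, rfl⟩ := List.append_of_mem (hmem u)
  have hsplit : ∀ x, G.Adj u x → x ∈ A ∨ x ∈ B := fun x hx => by
    simpa [hx.ne'] using hmem x
  rcases hsplit v huv with hvA | hvB
  · rcases hsplit w huw with hwA | hwB
    · obtain ⟨P, Q, rfl⟩ := List.append_of_mem hvA
      rcases List.mem_append.1 hwA with hwP | hwQ
      · obtain ⟨P, P', rfl⟩ := List.append_of_mem hwP
        rw [List.append_assoc P, List.cons_append (a := w)] at hl hFl
        exact Or.inr (hF.mem_extensions_of_mem_left hu hw hv huw hl hFl (by simp))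
      · exact Or.inl (hF.mem_extensions_of_mem_left hu hv hw huv hl hFl
          ((List.mem_cons.1 hwQ).resolve_left hvw.symm))
    · exact Or.inr (hF.mem_extensions_of_mem_right hu hw huw hl hFl hwB)
  · exact Or.inl (hF.mem_extensions_of_mem_right hu hv huv hl hFl hvB)

lemma IsLinearForest.card_interedges_le [DecidableRel G.Adj] (hF : IsLinearForest G F) :
    #(G.interedges (sinks F) (sources F)) ≤ #(extensions G F) + #(sinks F) := by
  rw [← tsub_le_iff_left, ← card_sdiff_of_subset extensions_subset_interedges]
  refine card_le_card_of_injOn Prod.fst (fun e he => ?_) ?_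
  · exact ((G.mem_interedges_iff).1 (Finset.mem_sdiff.1 he).1).1
  · rintro ⟨u, v⟩ hv ⟨-, w⟩ hw rfl
    simp only [coe_sdiff, Set.mem_sdiff, mem_coe, SimpleGraph.mem_interedges_iff] at hv hw
    by_contra hne
    rcases hF.mem_extensions_or hv.1.1 hv.1.2.1 hw.1.2.1 hv.1.2.2 hw.1.2.2
      fun h => hne (h ▸ rfl) with h | h
    exacts [hv.2 h, hw.2 h]

open scoped Classical in
/-- The linear forests of `G` with `s` arcs. -/
noncomputable def linearForests (G : SimpleGraph V) (s : ℕ) : Finset (Finset (V × V)) :=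
  {F | IsLinearForest G F ∧ #F = s}

lemma mem_linearForests : F ∈ linearForests G s ↔ IsLinearForest G F ∧ #F = s := by
  simp [linearForests]

variable (G) in
lemma card_linearForests_zero : #(linearForests G 0) = 1 := by
  refine card_eq_one.2 ⟨∅, ?_⟩
  ext F
  rw [mem_linearForests, card_eq_zero, mem_singleton, and_iff_right_of_imp]
  rintro rfl
  exact ⟨by simp, _, mem_orderings.2 ⟨nodup_toList univ, by simp⟩, empty_subset _⟩

lemma card_filter_superset_linearForests (hF : F ∈ linearForests G s) :
    #{F' ∈ linearForests G (s + 1) | F ⊆ F'} = #(extensions G F) := by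
  refine (card_bij (fun e _ => insert e F) (fun e he => ?_) (fun e he _e' _ h => ?_)
    fun F' hF' => ?_).symm
  · rw [mem_extensions] at he
    rw [mem_filter, mem_linearForests, card_insert_of_notMem he.1, (mem_linearForests.1 hF).2]
    exact ⟨⟨he.2, rfl⟩, subset_insert _ _⟩
  · have := h ▸ mem_insert_self e F
    exact (mem_insert.1 this).resolve_right (mem_extensions.1 he).1
  · rw [mem_filter, mem_linearForests, ← (mem_linearForests.1 hF).2] at hF'
    obtain ⟨e, he, rfl⟩ := exists_eq_insert_iff.2 ⟨hF'.2, hF'.1.2.symm⟩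
    exact ⟨e, mem_extensions.2 ⟨he, hF'.1.1⟩, rfl⟩

variable (G s) in
lemma sum_card_extensions :
    ∑ F ∈ linearForests G s, #(extensions G F) = (s + 1) * #(linearForests G (s + 1)) := by
  rw [← sum_congr rfl fun F hF => card_filter_superset_linearForests hF]
  refine (sum_card_bipartiteAbove_eq_sum_card_bipartiteBelow
    (fun F F' : Finset (V × V) => F ⊆ F')).trans ?_
  rw [mul_comm, ← smul_eq_mul]
  refine sum_const_nat fun F' hF' => ?_
  rw [mem_linearForests] at hF'
  have : (linearForests G s).bipartiteBelow (· ⊆ ·) F' = F'.powersetCard s := by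
    ext F
    rw [mem_bipartiteBelow, mem_powersetCard, mem_linearForests]
    exact ⟨fun h => ⟨h.2, h.1.2⟩, fun h => ⟨⟨hF'.1.subset h.1, h.2⟩, h.1⟩⟩
  rw [this, card_powersetCard, hF'.2, Nat.choose_succ_self_right]

lemma card_linearForests_le (hs : Fintype.card V ≤ s + m) :
    #(linearForests G s) ≤
      #{l ∈ orderings V | #(badEdges G l) ≤ m} * (Fintype.card V ^ 2 + 1) ^ m := by
  set R : Finset (Finset (V × V)) := {D | #D ≤ m}
  have hR : #R ≤ (Fintype.card V ^ 2 + 1) ^ m := by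
    simpa [sq] using card_filter_card_le (V × V) m
  choose! f hf hFf using fun F (hF : F ∈ linearForests G s) =>
    (mem_linearForests.1 hF).1.exists_steps
  have hcard : ∀ F ∈ linearForests G s, #(steps (f F) \ F) ≤ m := fun F hF => by
    rw [card_sdiff_of_subset (hFf F hF), card_steps (mem_orderings.1 (hf F hF)).1,
      length_of_mem_orderings (hf F hF), (mem_linearForests.1 hF).2]
    omega
  have hbad : ∀ F ∈ linearForests G s,
      badEdges G (f F) ⊆ (steps (f F) \ F).image Sym2.mk.uncurry := fun F hF e he => by
    obtain ⟨he, hnotAdj⟩ := mem_badEdges.1 he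
    obtain ⟨u, v, huv, rfl⟩ := mem_pathEdges.1 he
    refine mem_image.2 ⟨(u, v), Finset.mem_sdiff.2 ⟨huv, fun h => hnotAdj ?_⟩, rfl⟩
    exact (mem_linearForests.1 hF).1.adj _ h
  calc #(linearForests G s) ≤ #({l ∈ orderings V | #(badEdges G l) ≤ m} ×ˢ R) := by
        refine card_le_card_of_injOn (fun F => (f F, steps (f F) \ F)) (fun F hF => ?_)
          fun F hF F' hF' h => ?_
        · refine mem_coe.2 (mem_product.2 ⟨mem_filter.2 ⟨hf F hF, ?_⟩, ?_⟩)
          · exact (card_le_card (hbad F hF)).trans (card_image_le.trans (hcard F hF))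
          · exact mem_filter.2 ⟨mem_univ _, hcard F hF⟩
        · obtain ⟨hff, hsdiff⟩ := Prod.mk.inj h
          rw [← Finset.sdiff_sdiff_eq_self (hFf F hF), hsdiff, hff,
            Finset.sdiff_sdiff_eq_self (hFf F' hF')]
    _ ≤ _ := by rw [card_product]; gcongr

lemma card_cyclicOrderings_le :
    #(cyclicOrderings G) ≤ (Fintype.card V + 1) * #(linearForests G (Fintype.card V - 1)) := by
  rw [← Fintype.card_option, ← card_univ, ← card_product]
  refine card_le_card_of_injOn (fun l => (l.head?, steps l)) (fun l hl => ?_)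
    fun l hl l' hl' h => ?_
  · obtain ⟨hord, hbad, -⟩ := mem_cyclicOrderings.1 hl
    refine mem_coe.2 (mem_product.2 ⟨mem_univ _, mem_linearForests.2 ⟨⟨fun e he => ?_, l, hord,
      subset_rfl⟩, ?_⟩⟩)
    · by_contra hnotAdj
      exact notMem_empty s(e.1, e.2) (hbad ▸ mem_badEdges.2
        ⟨mem_pathEdges.2 ⟨e.1, e.2, he, rfl⟩, hnotAdj⟩)
    · rw [card_steps (mem_orderings.1 hord).1, length_of_mem_orderings hord]
  · obtain ⟨hhead, hsteps⟩ := Prod.mk.inj h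
    exact eq_of_head_eq_of_pathEdges_eq (mem_orderings.1 (mem_cyclicOrderings.1 hl).1).1
      (mem_orderings.1 (mem_cyclicOrderings.1 hl').1).1 hhead
      (congrArg (image Sym2.mk.uncurry) hsteps)

end LinearForests

section MixingLinearForests

variable {V : Type*} [DecidableEq V] [Fintype V] {G : SimpleGraph V} [DecidableRel G.Adj]
  {F : Finset (V × V)} {d μ : ℝ} {s : ℕ}

lemma IsLinearForest.card_extensions_le (hF : IsLinearForest G F) (h : Mixing G d μ) :
    (#(extensions G F) : ℝ) ≤
      d * (Fintype.card V - #F : ℕ) ^ 2 / Fintype.card V + μ * (Fintype.card V - #F : ℕ) := by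
  have hmix := h.le (sinks F) (sources F)
  rw [hF.card_sinks, hF.card_sources, mul_assoc d, ← sq, Real.sqrt_sq (Nat.cast_nonneg _)] at hmix
  exact (Nat.cast_le.2 (card_le_card extensions_subset_interedges)).trans hmix

lemma IsLinearForest.le_card_extensions (hF : IsLinearForest G F) (h : Mixing G d μ) :
    d * (Fintype.card V - #F : ℕ) ^ 2 / Fintype.card V - (μ + 1) * (Fintype.card V - #F : ℕ) ≤
      #(extensions G F) := by
  have hmix := h.ge (sinks F) (sources F)
  have hle : (#(G.interedges (sinks F) (sources F)) : ℝ) ≤ #(extensions G F) + #(sinks F) := by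
    exact_mod_cast hF.card_interedges_le
  rw [hF.card_sinks] at hmix hle
  rw [hF.card_sources, mul_assoc d, ← sq, Real.sqrt_sq (Nat.cast_nonneg _)] at hmix
  linarith

lemma factorial_succ_mul_card_linearForests (G : SimpleGraph V) (s : ℕ) :
    (((s + 1)! * #(linearForests G (s + 1)) : ℕ) : ℝ) =
      s ! * ∑ F ∈ linearForests G s, (#(extensions G F) : ℝ) := by
  rw [← Nat.cast_sum, sum_card_extensions, Nat.factorial_succ]
  push_cast
  ring

lemma Mixing.factorial_mul_card_linearForests_le [Nonempty V] (h : Mixing G d μ)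
    (hd : 0 ≤ d) {c : ℕ}
    (hc : μ * Fintype.card V ≤ c * d) (s : ℕ) :
    ((s ! * #(linearForests G s) : ℕ) : ℝ) ≤ (d / Fintype.card V) ^ s *
      ((Fintype.card V).descFactorial s * (Fintype.card V + c).descFactorial s : ℕ) := by
  set n := Fintype.card V
  have hn₀ : (0 : ℝ) < n := by exact_mod_cast Fintype.card_pos
  induction s with
  | zero => simp [card_linearForests_zero]
  | succ s ih =>
    have hext : ∀ F ∈ linearForests G s,
        (#(extensions G F) : ℝ) ≤ d / n * ((n - s) * (n + c - s) : ℕ) := fun F hF => by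
      rw [mem_linearForests] at hF
      calc (#(extensions G F) : ℝ)
          ≤ d * (n - s : ℕ) ^ 2 / n + μ * (n - s : ℕ) := hF.2 ▸ hF.1.card_extensions_le h
        _ = (n - s : ℕ) * (d * (n - s : ℕ) + μ * n) / n := by field_simp
        _ ≤ (n - s : ℕ) * (d * (n - s : ℕ) + c * d) / n := by gcongr
        _ = d / n * ((n - s) * (n - s + c) : ℕ) := by push_cast; ring
        _ ≤ d / n * ((n - s) * (n + c - s) : ℕ) := by
          gcongr ?_ * ((?_ : ℕ) : ℝ)
          rcases le_total s n with hs | hs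
          · rw [Nat.sub_add_comm hs]
          · simp [Nat.sub_eq_zero_of_le hs]
    calc (((s + 1)! * #(linearForests G (s + 1)) : ℕ) : ℝ)
        = s ! * ∑ F ∈ linearForests G s, (#(extensions G F) : ℝ) :=
          factorial_succ_mul_card_linearForests G s
      _ ≤ s ! * (#(linearForests G s) * (d / n * ((n - s) * (n + c - s) : ℕ))) := by
          gcongr
          simpa using sum_le_card_nsmul _ _ _ hext
      _ = (s ! * #(linearForests G s) : ℕ) * (d / n * ((n - s) * (n + c - s) : ℕ)) := by
          push_cast; ring
      _ ≤ (d / n) ^ s * (n.descFactorial s * (n + c).descFactorial s : ℕ) *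
          (d / n * ((n - s) * (n + c - s) : ℕ)) := by gcongr
      _ = _ := by
          rw [Nat.descFactorial_succ, Nat.descFactorial_succ]
          push_cast
          ring

lemma Mixing.le_factorial_mul_card_linearForests (h : Mixing G d μ) (hd : 0 ≤ d) {θ : ℝ}
    (hθ₀ : 0 ≤ θ) (hθ₁ : θ ≤ 1) {m : ℕ} (hm : (μ + 1) * Fintype.card V ≤ θ * d * m)
    (hs : s + m ≤ Fintype.card V) :
    ((1 - θ) * d / Fintype.card V) ^ s * ((Fintype.card V).descFactorial s : ℝ) ^ 2 ≤
      (s ! * #(linearForests G s) : ℕ) := by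
  set n := Fintype.card V
  have : 0 ≤ 1 - θ := sub_nonneg.2 hθ₁
  induction s with
  | zero => simp [card_linearForests_zero]
  | succ s ih =>
    have hn₀ : (0 : ℝ) < n := by exact_mod_cast (by omega : 0 < n)
    have hext : ∀ F ∈ linearForests G s,
        (1 - θ) * d / n * (n - s : ℕ) ^ 2 ≤ (#(extensions G F) : ℝ) := fun F hF => by
      rw [mem_linearForests] at hF
      have hms : (m : ℝ) ≤ (n - s : ℕ) := by exact_mod_cast (by omega : m ≤ n - s)
      calc (1 - θ) * d / n * (n - s : ℕ) ^ 2
          = d * (n - s : ℕ) ^ 2 / n - θ * d * (n - s : ℕ) / n * (n - s : ℕ) := by ring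
        _ ≤ d * (n - s : ℕ) ^ 2 / n - (μ + 1) * (n - s : ℕ) := by
          gcongr
          rw [le_div_iff₀ hn₀]
          refine hm.trans ?_
          gcongr
        _ ≤ #(extensions G F) := hF.2 ▸ hF.1.le_card_extensions h
    calc ((1 - θ) * d / n) ^ (s + 1) * (n.descFactorial (s + 1) : ℝ) ^ 2
        = ((1 - θ) * d / n) ^ s * (n.descFactorial s : ℝ) ^ 2 *
            ((1 - θ) * d / n * (n - s : ℕ) ^ 2) := by
          rw [Nat.descFactorial_succ]
          push_cast
          ring
      _ ≤ (s ! * #(linearForests G s) : ℕ) * ((1 - θ) * d / n * (n - s : ℕ) ^ 2) := by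
          gcongr
          exact ih (by omega)
      _ = s ! * (#(linearForests G s) * ((1 - θ) * d / n * (n - s : ℕ) ^ 2)) := by
          push_cast; ring
      _ ≤ s ! * ∑ F ∈ linearForests G s, (#(extensions G F) : ℝ) := by
          gcongr
          simpa using card_nsmul_le_sum _ _ _ hext
      _ = ((s + 1)! * #(linearForests G (s + 1)) : ℕ) :=
          (factorial_succ_mul_card_linearForests G s).symm

end MixingLinearForests

section HamiltonCycles

variable {V : Type*} [DecidableEq V] {G : SimpleGraph V} {u v : V} {l : List V}

lemma mem_edges_iff_mem_pathEdges_support (p : G.Walk u v) {e : Sym2 V} :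
    e ∈ p.edges ↔ e ∈ pathEdges p.support := by
  induction p with
  | nil => simp [mem_pathEdges_cons]
  | cons h p ih =>
    rw [SimpleGraph.Walk.edges_cons, List.mem_cons, ih, SimpleGraph.Walk.support_cons,
      mem_pathEdges_cons, List.head?_eq_some_head p.support_ne_nil]
    simp [or_comm]

lemma badEdges_eq_empty_iff_isChain : badEdges G l = ∅ ↔ l.IsChain G.Adj := by
  simp only [eq_empty_iff_forall_notMem, mem_badEdges, not_and, not_not]
  induction l with
  | nil => simp
  | cons a l ih =>
    have adj_iff : (∀ y ∈ l.head?, s(a, y) ∈ G.edgeSet) ↔ ∀ y ∈ l.head?, G.Adj a y := Iff.rfl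
    rw [List.isChain_cons, ← ih, ← adj_iff]
    simp only [mem_pathEdges_cons]
    grind

lemma mk_getLast_head_notMem_pathEdges (hl : l.Nodup) (h3 : 3 ≤ l.length)
    (hu : u ∈ l.head?) (hv : v ∈ l.getLast?) : s(v, u) ∉ pathEdges l := by
  match l, h3 with
  | a :: b :: c :: l, _ =>
    obtain rfl : a = u := by simpa using hu
    rw [mem_pathEdges_cons]
    rintro (h | ⟨y, hy, h⟩)
    · exact (List.nodup_cons.1 hl).1 (mem_of_mem_pathEdges h (Sym2.mem_mk_right v a))
    · obtain rfl : b = y := by simpa using hy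
      obtain rfl : v = b := by grind
      rw [List.getLast?_cons_cons, List.getLast?_cons_cons] at hv
      exact (List.nodup_cons.1 hl.of_cons).1 (List.mem_of_mem_getLast? hv)

variable [Fintype V]

lemma exists_isHamiltonianCycle_of_mem_cyclicOrderings (h3 : 3 ≤ Fintype.card V)
    (hl : l ∈ cyclicOrderings G) :
    ∃ (v : V) (p : G.Walk v v), p.IsHamiltonianCycle ∧ p.support = v :: l := by
  obtain ⟨hlo, hG, u, hu, v, hv, huv⟩ := mem_cyclicOrderings.1 hl
  have hlen := length_of_mem_orderings hlo
  rw [mem_orderings] at hlo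
  have hne : l ≠ [] := List.ne_nil_of_mem (List.mem_of_mem_head? hu)
  obtain ⟨p, hp⟩ : ∃ p : G.Walk u v, p.support = l := by
    obtain rfl : l.head hne = u := by simpa [List.head?_eq_some_head hne] using hu
    obtain rfl : l.getLast hne = v := by simpa [List.getLast?_eq_getLast_of_ne_nil hne] using hv
    exact ⟨SimpleGraph.Walk.ofSupport l hne (badEdges_eq_empty_iff_isChain.1 hG),
      SimpleGraph.Walk.support_ofSupport _ _⟩
  refine ⟨v, .cons huv.symm p, ?_, by rw [SimpleGraph.Walk.support_cons, hp]⟩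
  rw [SimpleGraph.Walk.isHamiltonianCycle_iff_isCycle_and_support_count_tail_eq_one,
    SimpleGraph.Walk.cons_isCycle_iff, SimpleGraph.Walk.isPath_def,
    mem_edges_iff_mem_pathEdges_support, SimpleGraph.Walk.support_cons, List.tail_cons, hp]
  exact ⟨⟨hlo.1, mk_getLast_head_notMem_pathEdges hlo.1 (hlen ▸ h3) hu hv⟩,
    fun a => List.count_eq_one_of_mem hlo.1 (hlo.2 a)⟩

omit [DecidableEq V] [Fintype V] in
lemma mem_getLast?_support_tail {p : G.Walk v v} (hp : p.support.tail ≠ []) :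
    v ∈ p.support.tail.getLast? := by
  rw [List.getLast?_eq_getLast_of_ne_nil hp, List.getLast_tail, p.getLast_support]
  rfl

lemma support_tail_mem_cyclicOrderings {p : G.Walk v v} (hp : p.IsHamiltonianCycle) :
    p.support.tail ∈ cyclicOrderings G := by
  have hcount :=
    (SimpleGraph.Walk.isHamiltonianCycle_iff_isCycle_and_support_count_tail_eq_one.1 hp).2
  have hne : p.support.tail ≠ [] := fun h => by simpa [h] using hcount v
  obtain ⟨u, t, ht⟩ := List.exists_cons_of_ne_nil hne
  have hchain : (v :: u :: t).IsChain G.Adj := by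
    rw [← ht, p.cons_tail_support]
    exact p.isChain_adj_support
  have horder : p.support.tail ∈ orderings V := mem_orderings.2 ⟨hp.isCycle.support_nodup,
    fun w => List.count_pos_iff.1 (by rw [hcount w]; exact one_pos)⟩
  exact mem_cyclicOrderings.2 ⟨horder,
    badEdges_eq_empty_iff_isChain.2 p.isChain_adj_support.tail, u, by simp [ht], v,
    mem_getLast?_support_tail hne, (List.isChain_cons_cons.1 hchain).1.symm⟩

lemma numHamiltonCycles_le_card_cyclicOrderings : G.numHamiltonCycles ≤ #(cyclicOrderings G) := by
  have tail_support : ∀ H ∈ {H : G.Subgraph | ∃ (v : V) (p : G.Walk v v),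
      p.IsHamiltonianCycle ∧ p.toSubgraph = H}, ∃ t ∈ cyclicOrderings G,
      ∃ (v : V) (p : G.Walk v v), p.support = v :: t ∧ v ∈ t.getLast? ∧ p.toSubgraph = H := by
    rintro H ⟨v, p, hp, rfl⟩
    have hmem := support_tail_mem_cyclicOrderings hp
    obtain ⟨-, -, u, hu, -⟩ := mem_cyclicOrderings.1 hmem
    exact ⟨_, hmem, v, p, p.cons_tail_support.symm,
      mem_getLast?_support_tail (List.ne_nil_of_mem (List.mem_of_mem_head? hu)), rfl⟩
  choose! f hf hf' using tail_support
  rw [SimpleGraph.numHamiltonCycles, ← Set.ncard_coe_finset]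
  refine Set.ncard_le_ncard_of_injOn f hf fun H hH H' hH' heq => ?_
  obtain ⟨v, p, hp, hv, rfl⟩ := hf' H hH
  obtain ⟨v', p', hp', hv', rfl⟩ := hf' H' hH'
  rw [← heq] at hp' hv'
  obtain rfl := Option.mem_unique hv hv'
  rw [SimpleGraph.Walk.ext_support (hp.trans hp'.symm)]

lemma exists_mem_pathEdges_iff (h3 : 3 ≤ Fintype.card V) (hl : l ∈ cyclicOrderings G) :
    ∃ (v : V) (p : G.Walk v v), p.IsHamiltonianCycle ∧ ∀ u ∈ l.head?, ∀ w ∈ l.getLast?,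
      ∀ e, e ∈ pathEdges l ↔ e ∈ p.toSubgraph.edgeSet ∧ e ≠ s(w, u) := by
  obtain ⟨v, p, hp, hsupp⟩ := exists_isHamiltonianCycle_of_mem_cyclicOrderings h3 hl
  refine ⟨v, p, hp, fun u hu w hw e => ?_⟩
  have hlo := (mem_cyclicOrderings.1 hl).1
  have hnot : s(w, u) ∉ pathEdges l := mk_getLast_head_notMem_pathEdges (mem_orderings.1 hlo).1
    (length_of_mem_orderings hlo ▸ h3) hu hw
  have hv := mem_getLast?_support_tail (p := p)
  rw [hsupp, List.tail_cons] at hv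
  obtain rfl : v = w := Option.mem_unique (hv (List.ne_nil_of_mem (List.mem_of_mem_head? hu))) hw
  rw [SimpleGraph.Walk.mem_edges_toSubgraph, mem_edges_iff_mem_pathEdges_support, hsupp,
    mem_pathEdges_cons, Option.mem_def.1 hu]
  simp only [Option.mem_some_iff, exists_eq_left']
  grind

lemma card_cyclicOrderings_le_numHamiltonCycles (h3 : 3 ≤ Fintype.card V) :
    #(cyclicOrderings G) ≤ G.numHamiltonCycles * (Fintype.card V + 1) ^ 2 := by
  classical
  set S := {H : G.Subgraph | ∃ (v : V) (p : G.Walk v v),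
    p.IsHamiltonianCycle ∧ p.toSubgraph = H}
  have hS : S.Finite := Set.toFinite S
  have pathEdges_iff : ∀ l ∈ cyclicOrderings G, ∃ H ∈ S, ∀ u ∈ l.head?, ∀ v ∈ l.getLast?,
      ∀ e, e ∈ pathEdges l ↔ e ∈ H.edgeSet ∧ e ≠ s(v, u) := fun l hl =>
    let ⟨v, p, hp, h⟩ := exists_mem_pathEdges_iff h3 hl
    ⟨_, ⟨v, p, hp, rfl⟩, h⟩
  rcases (cyclicOrderings G).eq_empty_or_nonempty with h₀ | ⟨l₀, hl₀⟩
  · simp [h₀]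
  have : Nonempty G.Subgraph := ⟨(pathEdges_iff l₀ hl₀).choose⟩
  choose! f hf hf' using pathEdges_iff
  calc #(cyclicOrderings G)
      ≤ #(hS.toFinset ×ˢ (univ : Finset (Option V × Option V))) := by
        refine card_le_card_of_injOn (fun l => (f l, l.head?, l.getLast?))
          (fun l hl => mem_product.2 ⟨hS.mem_toFinset.2 (hf l hl), mem_univ _⟩)
          fun l hl l' hl' heq => ?_
        obtain ⟨hff, hhead, hlast⟩ :
            f l = f l' ∧ l.head? = l'.head? ∧ l.getLast? = l'.getLast? := by
          simpa using heq
        have edges := hf' l hl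
        have edges' := hf' l' hl'
        obtain ⟨hlo, -, u, hu, v, hv, -⟩ := mem_cyclicOrderings.1 hl
        refine eq_of_head_eq_of_pathEdges_eq (mem_orderings.1 hlo).1
          (mem_orderings.1 (mem_cyclicOrderings.1 hl').1).1 hhead ?_
        ext e
        rw [edges u hu v hv, edges' u (hhead ▸ hu) v (hlast ▸ hv), hff]
    _ = G.numHamiltonCycles * (Fintype.card V + 1) ^ 2 := by
        rw [SimpleGraph.numHamiltonCycles, Set.ncard_eq_toFinset_card _ hS, card_product]
        simp [sq]

end HamiltonCycles

section CycleBounds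

variable {V : Type*} [DecidableEq V] [Fintype V] {G : SimpleGraph V} {c s m : ℕ}

lemma card_linearForests_le_card_cyclicOrderings
    (hclose : ∀ l ∈ orderings V, ∃ l', ModifiedBy G c l l' ∧ EndsAdj G l')
    (hs : Fintype.card V ≤ s + m) :
    #(linearForests G s) ≤
      #(cyclicOrderings G) * (Fintype.card V ^ 2 + 1) ^ ((m + 1) * (2 * c + 3)) := by
  set n := Fintype.card V
  have hn : n + 1 ≤ n ^ 2 + 1 := by grind [Nat.le_pow (a := n) two_pos]
  have few_bad : #{l ∈ orderings V | #(badEdges G l) ≤ m} ≤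
      #(cyclicOrderings G) * ((n + 1) * ((n ^ 2 + 1) ^ ((m + 1) * (c + 1))) ^ 2) := by
    refine card_le_of_close (filter_subset _ _) (fun l hl => (mem_cyclicOrderings.1 hl).1)
      fun l hl => ?_
    obtain ⟨hlo, hbad⟩ := mem_filter.1 hl
    obtain ⟨l', hl', hmod⟩ := exists_cyclicOrdering hclose hlo
    exact ⟨l', hl', hmod.card_sdiff.trans (by gcongr)⟩
  calc #(linearForests G s)
      ≤ #{l ∈ orderings V | #(badEdges G l) ≤ m} * (n ^ 2 + 1) ^ m := card_linearForests_le hs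
    _ ≤ #(cyclicOrderings G) * ((n ^ 2 + 1) * ((n ^ 2 + 1) ^ ((m + 1) * (c + 1))) ^ 2) *
          (n ^ 2 + 1) ^ m := by
        gcongr
        exact few_bad.trans (by gcongr)
    _ = #(cyclicOrderings G) * (n ^ 2 + 1) ^ ((m + 1) * (2 * c + 3)) := by ring

variable [DecidableRel G.Adj] {d μ θ : ℝ}

lemma Mixing.pow_mul_factorial_le (h : Mixing G d μ) (hd : 0 ≤ d) (hθ₀ : 0 ≤ θ) (hθ₁ : θ ≤ 1)
    (hm : (μ + 1) * Fintype.card V ≤ θ * d * m) (hs : s + m = Fintype.card V) :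
    ((1 - θ) * d / Fintype.card V) ^ s * (Fintype.card V)! ≤ (#(linearForests G s) * m ! : ℕ) := by
  set n := Fintype.card V
  set x := (1 - θ) * d / n
  have : 0 ≤ x := div_nonneg (mul_nonneg (sub_nonneg.2 hθ₁) hd) n.cast_nonneg
  have hfac : m ! * n.descFactorial s = n ! := by
    rw [← Nat.factorial_mul_descFactorial (n := n) (k := s) (by omega)]
    congr
    omega
  have hdesc : s ! ≤ n.descFactorial s := by
    rw [Nat.descFactorial_eq_factorial_mul_choose]
    exact Nat.le_mul_of_pos_right _ (Nat.choose_pos (by omega))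
  have key : x ^ s * n.descFactorial s ≤ #(linearForests G s) := by
    have hpos : (0 : ℝ) < n.descFactorial s := by
      exact_mod_cast (Nat.factorial_pos s).trans_le hdesc
    refine le_of_mul_le_mul_right ?_ hpos
    calc x ^ s * n.descFactorial s * n.descFactorial s
        = x ^ s * (n.descFactorial s : ℝ) ^ 2 := by ring
      _ ≤ (s ! * #(linearForests G s) : ℕ) :=
          h.le_factorial_mul_card_linearForests hd hθ₀ hθ₁ hm hs.le
      _ ≤ (n.descFactorial s * #(linearForests G s) : ℕ) := by gcongr
      _ = #(linearForests G s) * n.descFactorial s := by push_cast; ring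
  calc x ^ s * n ! = x ^ s * n.descFactorial s * m ! := by rw [← hfac]; push_cast; ring
    _ ≤ #(linearForests G s) * m ! := by gcongr
    _ = (#(linearForests G s) * m ! : ℕ) := by push_cast; ring

lemma Mixing.factorial_mul_pow_le_numHamiltonCycles (h : Mixing G d μ) (hd : 0 ≤ d)
    (hdn : d ≤ Fintype.card V) (h3 : 3 ≤ Fintype.card V)
    (hclose : ∀ l ∈ orderings V, ∃ l', ModifiedBy G c l l' ∧ EndsAdj G l')
    (hθ₀ : 0 ≤ θ) (hθ₁ : θ ≤ 1) (hm : (μ + 1) * Fintype.card V ≤ θ * d * m)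
    (hmn : m ≤ Fintype.card V) :
    (Fintype.card V)! * ((1 - θ) * d / Fintype.card V) ^ Fintype.card V ≤
      (G.numHamiltonCycles * (Fintype.card V ^ 2 + 1) ^ ((m + 1) * (2 * c + 5)) : ℕ) := by
  set n := Fintype.card V
  set x := (1 - θ) * d / n
  have hx₀ : 0 ≤ x := div_nonneg (mul_nonneg (sub_nonneg.2 hθ₁) hd) n.cast_nonneg
  have hx₁ : x ≤ 1 :=
    div_le_one_of_le₀ ((mul_le_of_le_one_left hd (by linarith)).trans hdn) n.cast_nonneg
  have hn : n ≤ n ^ 2 + 1 := (Nat.le_pow two_pos).trans (Nat.le_succ _)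
  have hn' : n + 1 ≤ n ^ 2 + 1 := by grind [Nat.le_pow (a := n) two_pos]
  have hforests : #(linearForests G (n - m)) * m ! ≤
      G.numHamiltonCycles * (n ^ 2 + 1) ^ ((m + 1) * (2 * c + 5)) :=
    calc #(linearForests G (n - m)) * m !
        ≤ #(cyclicOrderings G) * (n ^ 2 + 1) ^ ((m + 1) * (2 * c + 3)) * n ^ m := by
          gcongr
          · exact card_linearForests_le_card_cyclicOrderings hclose (by omega)
          · exact m.factorial_le_pow.trans (by gcongr)
      _ ≤ G.numHamiltonCycles * (n ^ 2 + 1) ^ 2 * (n ^ 2 + 1) ^ ((m + 1) * (2 * c + 3)) *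
            (n ^ 2 + 1) ^ m := by
          gcongr
          exact (card_cyclicOrderings_le_numHamiltonCycles h3).trans (by gcongr)
      _ = G.numHamiltonCycles * (n ^ 2 + 1) ^ (2 + (m + 1) * (2 * c + 3) + m) := by ring
      _ ≤ G.numHamiltonCycles * (n ^ 2 + 1) ^ ((m + 1) * (2 * c + 5)) := by
          gcongr
          · omega
          · linarith
  calc (n ! : ℝ) * x ^ n ≤ n ! * x ^ (n - m) := by
        gcongr ?_ * ?_
        exact pow_le_pow_of_le_one hx₀ hx₁ (Nat.sub_le _ _)
    _ = x ^ (n - m) * n ! := mul_comm _ _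
    _ ≤ (#(linearForests G (n - m)) * m ! : ℕ) :=
        h.pow_mul_factorial_le hd hθ₀ hθ₁ hm (Nat.sub_add_cancel hmn)
    _ ≤ _ := by exact_mod_cast hforests

lemma Mixing.card_linearForests_card_sub_one_le [Nonempty V] (h : Mixing G d μ) (hd : 0 ≤ d)
    (hc : μ * Fintype.card V ≤ c * d) (hcn : c ≤ Fintype.card V) :
    #(linearForests G (Fintype.card V - 1)) ≤ (Fintype.card V)! *
      (d / Fintype.card V) ^ (Fintype.card V - 1) * (2 * Fintype.card V : ℝ) ^ (c + 1) := by
  have hforests := h.factorial_mul_card_linearForests_le hd hc (Fintype.card V - 1)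
  obtain ⟨s, hs⟩ := Nat.exists_eq_add_of_lt (Fintype.card_pos (α := V))
  rw [zero_add] at hs
  rw [hs] at hcn
  have hdesc : (s + 1 + c).descFactorial s ≤ s ! * (2 * (s + 1)) ^ (c + 1) := by
    rw [Nat.descFactorial_eq_factorial_mul_choose]
    gcongr
    calc (s + 1 + c).choose s = (s + 1 + c).choose (c + 1) :=
          Nat.choose_symm_of_eq_add (by ring)
      _ ≤ (s + 1 + c) ^ (c + 1) := Nat.choose_le_pow _ _
      _ ≤ (2 * (s + 1)) ^ (c + 1) := by gcongr; omega
  have hfac : (s + 1).descFactorial s = (s + 1)! := by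
    simpa using Nat.factorial_mul_descFactorial (Nat.le_succ s)
  rw [hs, Nat.add_sub_cancel, hfac] at hforests
  rw [hs, Nat.add_sub_cancel]
  refine le_of_mul_le_mul_left ?_ (by positivity : (0 : ℝ) < s !)
  calc (s ! * #(linearForests G s) : ℝ) = (s ! * #(linearForests G s) : ℕ) := by push_cast; rfl
    _ ≤ (d / (s + 1 : ℕ)) ^ s * ((s + 1)! * (s + 1 + c).descFactorial s : ℕ) := hforests
    _ ≤ (d / (s + 1 : ℕ)) ^ s * ((s + 1)! * (s ! * (2 * (s + 1)) ^ (c + 1)) : ℕ) := by gcongr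
    _ = s ! * ((s + 1)! * (d / (s + 1 : ℕ)) ^ s * (2 * (s + 1 : ℕ)) ^ (c + 1)) := by
        push_cast
        ring

lemma Mixing.numHamiltonCycles_le [Nonempty V] (h : Mixing G d μ) (hd : 1 ≤ d)
    (hc : μ * Fintype.card V ≤ c * d) (hcn : c ≤ Fintype.card V) :
    (G.numHamiltonCycles : ℝ) ≤ (Fintype.card V)! * (d / Fintype.card V) ^ Fintype.card V *
      (2 * Fintype.card V) ^ (c + 3) := by
  set n := Fintype.card V
  have hn : 0 < n := Fintype.card_pos
  have hn' : (1 : ℝ) ≤ n := by exact_mod_cast hn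
  calc (G.numHamiltonCycles : ℝ) ≤ #(cyclicOrderings G) := by
        exact_mod_cast numHamiltonCycles_le_card_cyclicOrderings
    _ ≤ (n + 1) * #(linearForests G (n - 1)) := by exact_mod_cast card_cyclicOrderings_le
    _ ≤ (n + 1) * (n ! * (d / n) ^ (n - 1) * (2 * n : ℝ) ^ (c + 1)) := by
        gcongr
        exact h.card_linearForests_card_sub_one_le (by linarith) hc hcn
    _ ≤ (n + 1) * (n ! * ((d / n) ^ n * n) * (2 * n : ℝ) ^ (c + 1)) := by
        gcongr
        calc (d / n) ^ (n - 1) ≤ (d / n) ^ (n - 1) * d := le_mul_of_one_le_right (by positivity) hd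
          _ = (d / n) ^ (n - 1) * (d / n) * n := by field_simp
          _ = (d / n) ^ n * n := by rw [pow_sub_one_mul hn.ne']
    _ = n ! * (d / n) ^ n * ((n + 1) * n * (2 * n : ℝ) ^ (c + 1)) := by ring
    _ ≤ n ! * (d / n) ^ n * ((2 * n) * (2 * n) * (2 * n : ℝ) ^ (c + 1)) := by
        gcongr <;> linarith
    _ = n ! * (d / n) ^ n * (2 * n) ^ (c + 3) := by ring

end CycleBounds

section Spectral

open scoped RealInnerProductSpace

variable {ι E : Type*} [Fintype ι] [NormedAddCommGroup E] [InnerProductSpace ℝ E]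
  {b : OrthonormalBasis ι ℝ E} {T : E →ₗ[ℝ] E} {ev : ι → ℝ} {i₀ : ι} {lam d ε : ℝ} {w x y : E}

lemma inner_basis_apply (hT : ∀ i, T (b i) = ev i • b i) (i : ι) (x : E) :
    ⟪b i, T x⟫ = ev i * ⟪b i, x⟫ := by
  classical
  conv_lhs => rw [← b.sum_repr' x]
  simp [hT, inner_sum, inner_smul_right, b.inner_eq_ite, mul_comm]

lemma inner_apply_eq_sum (hT : ∀ i, T (b i) = ev i • b i) (x y : E) :
    ⟪x, T y⟫ = ∑ i, ev i * (⟪b i, x⟫ * ⟪b i, y⟫) := by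
  rw [← b.sum_inner_mul_inner]
  refine sum_congr rfl fun i _ => ?_
  rw [inner_basis_apply hT, real_inner_comm]
  ring

lemma isSymmetric_of_apply_basis (hT : ∀ i, T (b i) = ev i • b i) : T.IsSymmetric := fun x y => by
  rw [real_inner_comm, inner_apply_eq_sum hT, inner_apply_eq_sum hT]
  simp only [mul_comm]

lemma abs_inner_apply_sub_le (hT : ∀ i, T (b i) = ev i • b i) (hlam : 0 ≤ lam)
    (hev : ∀ i ≠ i₀, |ev i| ≤ lam) (x y : E) :
    |⟪x, T y⟫ - ev i₀ * (⟪b i₀, x⟫ * ⟪b i₀, y⟫)| ≤ lam * (‖x‖ * ‖y‖) := by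
  classical
  have hexp : ⟪x, T y⟫ - ev i₀ * (⟪b i₀, x⟫ * ⟪b i₀, y⟫) =
      ∑ i ∈ univ.erase i₀, ev i * (⟪b i, x⟫ * ⟪b i, y⟫) := by
    rw [inner_apply_eq_sum hT, ← add_sum_erase univ _ (mem_univ i₀), add_sub_cancel_left]
  have norm_eq (z : E) : √(∑ i, |⟪b i, z⟫| ^ 2) = ‖z‖ := by
    simp_rw [← Real.norm_eq_abs]
    rw [b.sum_sq_norm_inner_right, Real.sqrt_sq (norm_nonneg z)]
  calc |⟪x, T y⟫ - ev i₀ * (⟪b i₀, x⟫ * ⟪b i₀, y⟫)|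
      ≤ ∑ i ∈ univ.erase i₀, |ev i * (⟪b i, x⟫ * ⟪b i, y⟫)| := hexp ▸ abs_sum_le_sum_abs _ _
    _ ≤ ∑ i ∈ univ.erase i₀, lam * (|⟪b i, x⟫| * |⟪b i, y⟫|) := by
        refine sum_le_sum fun i hi => ?_
        rw [abs_mul, abs_mul]
        gcongr
        exact hev i (ne_of_mem_erase hi)
    _ ≤ ∑ i, lam * (|⟪b i, x⟫| * |⟪b i, y⟫|) :=
        sum_le_sum_of_subset_of_nonneg (erase_subset _ _) fun i _ _ => by positivity
    _ = lam * ∑ i, |⟪b i, x⟫| * |⟪b i, y⟫| := (mul_sum _ _ _).symm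
    _ ≤ lam * (√(∑ i, |⟪b i, x⟫| ^ 2) * √(∑ i, |⟪b i, y⟫| ^ 2)) := by
        gcongr
        exact Real.sum_mul_le_sqrt_mul_sqrt _ _ _
    _ = lam * (‖x‖ * ‖y‖) := by rw [norm_eq, norm_eq]

lemma norm_le_norm_of_forall_abs_inner_le (h : ∀ i, |⟪b i, x⟫| ≤ |⟪b i, y⟫|) : ‖x‖ ≤ ‖y‖ := by
  refine (pow_le_pow_iff_left₀ (norm_nonneg x) (norm_nonneg y) two_ne_zero).1 ?_
  rw [← b.sum_sq_inner_right, ← b.sum_sq_inner_right]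
  exact sum_le_sum fun i _ => sq_le_sq.2 (h i)

lemma mul_norm_sub_inner_smul_le (hT : ∀ i, T (b i) = ev i • b i) (hd : 0 ≤ d)
    (hev : ∀ i ≠ i₀, |ev i| ≤ d / 2) (w : E) :
    d * ‖w - ⟪b i₀, w⟫ • b i₀‖ ≤ 2 * ‖T w - d • w‖ := by
  have hnorm : ‖(d / 2) • (w - ⟪b i₀, w⟫ • b i₀)‖ ≤ ‖T w - d • w‖ := by
    refine norm_le_norm_of_forall_abs_inner_le (b := b) fun i => ?_
    simp only [inner_sub_right, inner_smul_right, inner_basis_apply hT]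
    rcases eq_or_ne i i₀ with rfl | hi
    · simp
    · rw [b.inner_eq_zero hi, mul_zero, sub_zero, ← sub_mul, abs_mul, abs_mul,
        abs_of_nonneg (by positivity : 0 ≤ d / 2)]
      gcongr
      linarith [(abs_le.1 (hev i hi)).2, neg_le_abs (ev i - d)]
  rw [norm_smul, Real.norm_of_nonneg (by positivity)] at hnorm
  linarith

lemma abs_eigenvalue_le_and_abs_inner_le (hT : ∀ i, T (b i) = ev i • b i)
    (hd : 0 < d) (hev : ∀ i ≠ i₀, |ev i| ≤ d / 2) (hw₀ : w ≠ 0) (hε : 4 * ε ≤ d)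
    (hw : ‖T w - d • w‖ ≤ ε * ‖w‖) :
    |ev i₀| ≤ 3 / 2 * d ∧ ∀ x, ⟪w, x⟫ = 0 → d * |⟪b i₀, x⟫| ≤ 4 * ε * ‖x‖ := by
  set a := ⟪b i₀, w⟫
  have hW : 0 < ‖w‖ := norm_pos_iff.2 hw₀
  have hdev : d * ‖w - a • b i₀‖ ≤ 2 * ε * ‖w‖ := by
    linarith [mul_norm_sub_inner_smul_le hT hd.le hev w]
  have ha : ‖w‖ ≤ 2 * |a| := by
    have hdist : ‖w - a • b i₀‖ ≤ ‖w‖ / 2 := by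
      refine le_of_mul_le_mul_left (hdev.trans ?_) hd
      nlinarith
    have htri : ‖w‖ ≤ ‖w - a • b i₀‖ + ‖a • b i₀‖ := by
      simpa using norm_add_le (w - a • b i₀) (a • b i₀)
    rw [norm_smul, b.norm_eq_one, mul_one, Real.norm_eq_abs] at htri
    linarith
  constructor
  · have hcoord : |ev i₀ - d| * |a| ≤ d / 2 * |a| :=
      calc |ev i₀ - d| * |a| = |⟪b i₀, T w - d • w⟫| := by
            rw [inner_sub_right, inner_smul_right, inner_basis_apply hT, ← sub_mul, abs_mul]
        _ ≤ ‖b i₀‖ * ‖T w - d • w‖ := abs_real_inner_le_norm _ _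
        _ ≤ ε * ‖w‖ := by rwa [b.norm_eq_one, one_mul]
        _ ≤ d / 4 * ‖w‖ := by gcongr; linarith
        _ ≤ d / 4 * (2 * |a|) := by gcongr
        _ = d / 2 * |a| := by ring
    have hclose := abs_le.1 (le_of_mul_le_mul_right hcoord (by linarith))
    exact abs_le.2 ⟨by linarith, by linarith⟩
  · intro x hx
    refine le_of_mul_le_mul_left ?_ hW
    calc ‖w‖ * (d * |⟪b i₀, x⟫|) ≤ 2 * |a| * (d * |⟪b i₀, x⟫|) := by gcongr
      _ = 2 * d * |⟪w - a • b i₀, x⟫| := by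
          rw [inner_sub_left, hx, zero_sub, abs_neg, real_inner_smul_left, abs_mul]
          ring
      _ ≤ 2 * d * (‖w - a • b i₀‖ * ‖x‖) := by gcongr; exact abs_real_inner_le_norm _ _
      _ = 2 * (d * ‖w - a • b i₀‖) * ‖x‖ := by ring
      _ ≤ 2 * (2 * ε * ‖w‖) * ‖x‖ := by gcongr
      _ = ‖w‖ * (4 * ε * ‖x‖) := by ring

lemma abs_inner_apply_le_of_orthogonal (hT : ∀ i, T (b i) = ev i • b i) (hlam : 0 ≤ lam)
    (hev : ∀ i ≠ i₀, |ev i| ≤ lam) (hd : 0 < d) (hlamd : 2 * lam ≤ d) (hw₀ : w ≠ 0)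
    (hε : 4 * ε ≤ d) (hw : ‖T w - d • w‖ ≤ ε * ‖w‖) (hx : ⟪w, x⟫ = 0) (hy : ⟪w, y⟫ = 0) :
    |⟪x, T y⟫| ≤ (lam + 6 * ε) * (‖x‖ * ‖y‖) := by
  have hε₀ : 0 ≤ ε :=
    nonneg_of_mul_nonneg_left ((norm_nonneg _).trans hw) (norm_pos_iff.2 hw₀)
  obtain ⟨htop, hcoord⟩ := abs_eigenvalue_le_and_abs_inner_le hT hd
    (fun i hi => (hev i hi).trans (by linarith)) hw₀ hε hw
  have hdom : |ev i₀ * (⟪b i₀, x⟫ * ⟪b i₀, y⟫)| ≤ 6 * ε * (‖x‖ * ‖y‖) := by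
    refine le_of_mul_le_mul_left ?_ (by positivity : 0 < d ^ 2)
    calc d ^ 2 * |ev i₀ * (⟪b i₀, x⟫ * ⟪b i₀, y⟫)|
        = |ev i₀| * ((d * |⟪b i₀, x⟫|) * (d * |⟪b i₀, y⟫|)) := by
          rw [abs_mul, abs_mul]
          ring
      _ ≤ 3 / 2 * d * ((4 * ε * ‖x‖) * (4 * ε * ‖y‖)) := by
          gcongr ?_ * (?_ * ?_)
          exacts [hcoord x hx, hcoord y hy]
      _ = 6 * ε * d * (4 * ε) * (‖x‖ * ‖y‖) := by ring
      _ ≤ 6 * ε * d * d * (‖x‖ * ‖y‖) := by gcongr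
      _ = d ^ 2 * (6 * ε * (‖x‖ * ‖y‖)) := by ring
  calc |⟪x, T y⟫|
      = |(⟪x, T y⟫ - ev i₀ * (⟪b i₀, x⟫ * ⟪b i₀, y⟫)) + ev i₀ * (⟪b i₀, x⟫ * ⟪b i₀, y⟫)| := by
        rw [sub_add_cancel]
    _ ≤ lam * (‖x‖ * ‖y‖) + 6 * ε * (‖x‖ * ‖y‖) :=
        (abs_add_le _ _).trans (add_le_add (abs_inner_apply_sub_le hT hlam hev x y) hdom)
    _ = (lam + 6 * ε) * (‖x‖ * ‖y‖) := by ring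

lemma inner_sub_inner_div_smul_eq_zero (w z : E) :
    ⟪w, z - (⟪w, z⟫ / ‖w‖ ^ 2) • w⟫ = 0 := by
  rcases eq_or_ne w 0 with rfl | hw
  · exact inner_zero_left _
  · rw [inner_sub_right, real_inner_smul_right, real_inner_self_eq_norm_sq,
      div_mul_cancel₀ _ (pow_ne_zero 2 (norm_ne_zero_iff.2 hw)), sub_self]

lemma norm_sub_inner_div_smul_le (w z : E) : ‖z - (⟪w, z⟫ / ‖w‖ ^ 2) • w‖ ≤ ‖z‖ := by
  have h := (ℝ ∙ w)ᗮ.norm_starProjection_apply_le z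
  rw [Submodule.starProjection_orthogonal_val, Submodule.starProjection_singleton] at h
  simpa using h

lemma abs_inner_div_mul_norm_le (w z : E) : |⟪w, z⟫ / ‖w‖ ^ 2| * ‖w‖ ≤ ‖z‖ := by
  have h := (ℝ ∙ w).norm_starProjection_apply_le z
  rwa [Submodule.starProjection_singleton, norm_smul] at h

lemma inner_apply_sub_eq_add (hT : T.IsSymmetric) {a : ℝ} (hx : ⟪w, x - a • w⟫ = 0)
    (c d : ℝ) (y : E) :
    ⟪x, T y⟫ - d * a * ⟪w, y⟫ =
      ⟪x - a • w, T (y - c • w)⟫ + a * ⟪T w - d • w, y⟫ + c * ⟪x - a • w, T w - d • w⟫ := by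
  have hTy : ⟪x - a • w, T y⟫ = ⟪x, T y⟫ - a * ⟪T w, y⟫ := by
    rw [inner_sub_left, real_inner_smul_left, hT w y]
  rw [map_sub, map_smul, inner_sub_right, inner_sub_right (x - a • w) (T w), real_inner_smul_right,
    real_inner_smul_right, real_inner_comm w, hx, hTy, inner_sub_left (T w), real_inner_smul_left]
  ring

lemma abs_inner_apply_sub_inner_mul_inner_le (hT : ∀ i, T (b i) = ev i • b i) (hlam : 0 ≤ lam)
    (hev : ∀ i ≠ i₀, |ev i| ≤ lam) (hd : 0 < d) (hlamd : 2 * lam ≤ d) (hw₀ : w ≠ 0)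
    (hε : 4 * ε ≤ d) (hw : ‖T w - d • w‖ ≤ ε * ‖w‖) (x y : E) :
    |⟪x, T y⟫ - d * ⟪w, x⟫ * ⟪w, y⟫ / ‖w‖ ^ 2| ≤ (lam + 8 * ε) * (‖x‖ * ‖y‖) := by
  have hε₀ : 0 ≤ ε :=
    nonneg_of_mul_nonneg_left ((norm_nonneg _).trans hw) (norm_pos_iff.2 hw₀)
  set coeff : E → ℝ := fun z => ⟪w, z⟫ / ‖w‖ ^ 2 with hcoeff
  set r := T w - d • w
  set perp : E → E := fun z => z - coeff z • w
  have inner_perp (z : E) : ⟪w, perp z⟫ = 0 := inner_sub_inner_div_smul_eq_zero w z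
  have norm_perp (z : E) : ‖perp z‖ ≤ ‖z‖ := norm_sub_inner_div_smul_le w z
  have norm_coeff (z : E) : |coeff z| * ‖w‖ ≤ ‖z‖ := abs_inner_div_mul_norm_le w z
  have hsplit : ⟪x, T y⟫ - d * ⟪w, x⟫ * ⟪w, y⟫ / ‖w‖ ^ 2 =
      ⟪perp x, T (perp y)⟫ + coeff x * ⟪r, y⟫ + coeff y * ⟪perp x, r⟫ := by
    rw [← inner_apply_sub_eq_add (isSymmetric_of_apply_basis hT) (inner_perp x) (coeff y) d y,
      hcoeff]
    ring
  calc |⟪x, T y⟫ - d * ⟪w, x⟫ * ⟪w, y⟫ / ‖w‖ ^ 2|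
      ≤ |⟪perp x, T (perp y)⟫| + |coeff x| * |⟪r, y⟫| + |coeff y| * |⟪perp x, r⟫| := by
        rw [hsplit, ← abs_mul, ← abs_mul]
        exact abs_add_three _ _ _
    _ ≤ (lam + 6 * ε) * (‖x‖ * ‖y‖) + |coeff x| * (ε * ‖w‖ * ‖y‖) +
          |coeff y| * (‖x‖ * (ε * ‖w‖)) := by
        gcongr
        · exact (abs_inner_apply_le_of_orthogonal hT hlam hev hd hlamd hw₀ hε hw (inner_perp x)
            (inner_perp y)).trans (by gcongr <;> exact norm_perp _)
        · exact (abs_real_inner_le_norm _ _).trans (by gcongr)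
        · exact (abs_real_inner_le_norm _ _).trans (by gcongr; exact norm_perp x)
    _ = (lam + 6 * ε) * (‖x‖ * ‖y‖) + ε * (|coeff x| * ‖w‖ * ‖y‖) +
          ε * (|coeff y| * ‖w‖ * ‖x‖) := by ring
    _ ≤ (lam + 6 * ε) * (‖x‖ * ‖y‖) + ε * (‖x‖ * ‖y‖) + ε * (‖y‖ * ‖x‖) := by
        gcongr
        exacts [norm_coeff x, norm_coeff y]
    _ = (lam + 8 * ε) * (‖x‖ * ‖y‖) := by ring

end Spectral

section MixingOfSpectrum

open scoped Matrix RealInnerProductSpace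

variable {V : Type*} [DecidableEq V] [Fintype V] {G : SimpleGraph V} [DecidableRel G.Adj]
  {d ε lam : ℝ}

/-- The indicator of a set of vertices, as a vector of the Euclidean space on which the adjacency
matrix acts. -/
noncomputable def indicatorVec (S : Finset V) : EuclideanSpace ℝ V :=
  WithLp.toLp 2 fun v => if v ∈ S then 1 else 0

lemma inner_indicatorVec_indicatorVec (S T : Finset V) :
    ⟪indicatorVec S, indicatorVec T⟫ = #(S ∩ T) := by
  simp [indicatorVec, PiLp.inner_apply, inter_comm]

lemma norm_indicatorVec (S : Finset V) : ‖indicatorVec S‖ = √(#S) := by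
  rw [norm_eq_sqrt_real_inner, inner_indicatorVec_indicatorVec, inter_self]

lemma adjMatrix_indicatorVec_apply (T : Finset V) (v : V) :
    Matrix.toEuclideanLin (G.adjMatrix ℝ) (indicatorVec T) v = #{w ∈ T | G.Adj v w} := by
  simp [indicatorVec, Matrix.toLpLin_apply, Matrix.mulVec, dotProduct,
    SimpleGraph.adjMatrix_apply, ← ite_and, filter_and, ← filter_mem_eq_inter]

lemma inner_adjMatrix_indicatorVec (S T : Finset V) :
    ⟪indicatorVec S, Matrix.toEuclideanLin (G.adjMatrix ℝ) (indicatorVec T)⟫ =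
      #(G.interedges S T) := by
  simp only [PiLp.inner_apply, adjMatrix_indicatorVec_apply]
  simp [indicatorVec, card_interedges_eq_sum]

lemma norm_adjMatrix_indicatorVec_sub_le (hdeg : ∀ v, |(G.degree v : ℝ) - d| ≤ ε) (hε : 0 ≤ ε) :
    ‖Matrix.toEuclideanLin (G.adjMatrix ℝ) (indicatorVec univ) - d • indicatorVec univ‖ ≤
      ε * ‖(indicatorVec univ : EuclideanSpace ℝ V)‖ := by
  have hcoord (v : V) : (Matrix.toEuclideanLin (G.adjMatrix ℝ) (indicatorVec univ) -
      d • indicatorVec univ : EuclideanSpace ℝ V) v = G.degree v - d := by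
    rw [PiLp.sub_apply, adjMatrix_indicatorVec_apply, ← SimpleGraph.neighborFinset_eq_filter,
      SimpleGraph.card_neighborFinset_eq_degree]
    simp [indicatorVec]
  rw [← Real.norm_of_nonneg hε, ← norm_smul, EuclideanSpace.norm_eq, EuclideanSpace.norm_eq]
  refine Real.sqrt_le_sqrt (sum_le_sum fun v _ => ?_)
  rw [hcoord, Real.norm_eq_abs]
  gcongr
  simpa [indicatorVec, abs_of_nonneg hε] using hdeg v

lemma exists_orthonormalBasis_of_nontrivialEigenvaluesLE [Nonempty V]
    (h : G.NontrivialEigenvaluesLE lam) :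
    ∃ (b : OrthonormalBasis V ℝ (EuclideanSpace ℝ V)) (ev : V → ℝ) (i₀ : V),
      (∀ i, Matrix.toEuclideanLin (G.adjMatrix ℝ) (b i) = ev i • b i) ∧
        ∀ i ≠ i₀, |ev i| ≤ lam := by
  set hA := G.isHermitian_adjMatrix ℝ
  set e : Fin (Fintype.card V) ≃ V := Fintype.equivOfCardEq (Fintype.card_fin _)
  refine ⟨hA.eigenvectorBasis, hA.eigenvalues, e ⟨0, Fintype.card_pos⟩, fun i => ?_,
    fun i hi => ?_⟩
  · rw [Matrix.toLpLin_apply, hA.mulVec_eigenvectorBasis]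
    rfl
  · exact h (e.symm i) fun h₀ => hi ((e.symm_apply_eq).1 (Fin.ext h₀))

lemma mixing_of_nontrivialEigenvaluesLE [Nonempty V] (h : G.NontrivialEigenvaluesLE lam)
    (hlam : 0 ≤ lam) (hd : 0 < d) (hlamd : 2 * lam ≤ d) (hεd : 4 * ε ≤ d)
    (hdeg : ∀ v, |(G.degree v : ℝ) - d| ≤ ε) : Mixing G d (lam + 8 * ε) := by
  obtain ⟨b, ev, i₀, hb, hev⟩ := exists_orthonormalBasis_of_nontrivialEigenvaluesLE h
  have hone : (indicatorVec univ : EuclideanSpace ℝ V) ≠ 0 := by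
    rw [← norm_ne_zero_iff, norm_indicatorVec]
    positivity
  have hε : 0 ≤ ε := (abs_nonneg _).trans (hdeg (Classical.arbitrary V))
  intro S T
  have hquad := abs_inner_apply_sub_inner_mul_inner_le hb hlam hev hd hlamd hone hεd
    (norm_adjMatrix_indicatorVec_sub_le hdeg hε) (indicatorVec S) (indicatorVec T)
  simpa only [inner_adjMatrix_indicatorVec, inner_indicatorVec_indicatorVec, norm_indicatorVec,
    univ_inter, card_univ, Real.sq_sqrt (Nat.cast_nonneg _),
    ← Real.sqrt_mul (Nat.cast_nonneg (#S))] using hquad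

end MixingOfSpectrum

section AverageDegree

variable {V : Type*} [Fintype V] {G : SimpleGraph V} [DecidableRel G.Adj] {d μ : ℝ}

lemma avgDegree_nonneg : 0 ≤ G.avgDegree :=
  div_nonneg (sum_nonneg fun _ _ => Nat.cast_nonneg _) (Nat.cast_nonneg _)

lemma avgDegree_le_card : G.avgDegree ≤ Fintype.card V := by
  refine div_le_of_le_mul₀ (by positivity) (by positivity) ?_
  calc ∑ v, (G.degree v : ℝ) ≤ ∑ _v : V, (Fintype.card V : ℝ) :=
        sum_le_sum fun v _ => by exact_mod_cast (G.degree_lt_card_verts v).le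
    _ = Fintype.card V * Fintype.card V := by simp

lemma abs_degree_sub_avgDegree_le (v : V) :
    |(G.degree v : ℝ) - G.avgDegree| ≤ (G.maxDegree : ℝ) - G.minDegree := by
  have hcard : (0 : ℝ) < Fintype.card V := by exact_mod_cast Fintype.card_pos_iff.2 ⟨v⟩
  have hmax : G.avgDegree ≤ G.maxDegree := by
    rw [SimpleGraph.avgDegree, div_le_iff₀' hcard, ← nsmul_eq_mul]
    exact sum_le_card_nsmul _ _ _ fun w _ => by exact_mod_cast G.degree_le_maxDegree w
  have hmin : (G.minDegree : ℝ) ≤ G.avgDegree := by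
    rw [SimpleGraph.avgDegree, le_div_iff₀' hcard, ← nsmul_eq_mul]
    exact card_nsmul_le_sum _ _ _ fun w _ => by exact_mod_cast G.minDegree_le_degree w
  exact abs_sub_le_of_le_of_le (by exact_mod_cast G.minDegree_le_degree v)
    (by exact_mod_cast G.degree_le_maxDegree v) hmin hmax

lemma Mixing.one_le_two_mul (h : Mixing G d μ) {u : V} (hu : 0 < G.degree u) : 1 ≤ 2 * μ := by
  obtain ⟨v, huv⟩ := (G.degree_pos_iff_exists_adj u).1 hu
  have hloop := abs_le.1 (h {u} {u})
  have hedge := abs_le.1 (h {u} {v})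
  have hloop_card : #(G.interedges {u} {u}) = 0 := by
    simp [SimpleGraph.interedges, Rel.interedges, filter_singleton]
  have hedge_card : #(G.interedges {u} {v}) = 1 := by
    simp [SimpleGraph.interedges, Rel.interedges, filter_singleton, huv]
  simp only [hloop_card, hedge_card, card_singleton, Nat.cast_zero, Nat.cast_one, mul_one,
    Real.sqrt_one] at hloop hedge
  linarith [hloop.1, hedge.2]

end AverageDegree

section ErrorRate

lemma exp_neg_two_mul_le_one_sub {x : ℝ} (hx₀ : 0 ≤ x) (hx : x ≤ 1 / 2) :
    Real.exp (-(2 * x)) ≤ 1 - x := by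
  have hpos : 0 < 1 - x := by linarith
  rw [← Real.le_log_iff_exp_le hpos]
  refine le_trans ?_ (Real.one_sub_inv_le_log_of_pos hpos)
  rw [le_sub_comm, inv_le_iff_one_le_mul₀ hpos]
  nlinarith

lemma pow_le_exp_pow {x y : ℝ} {k n : ℕ} (hx : 0 < x) (h : k * Real.log x ≤ n * y) :
    x ^ k ≤ Real.exp y ^ n := by
  rw [← Real.exp_nat_mul, ← Real.exp_log (pow_pos hx k), Real.log_pow]
  exact Real.exp_le_exp.2 h

lemma two_le_of_one_le_log {n : ℕ} (hlog : 1 ≤ Real.log n) : 2 ≤ n := by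
  by_contra! h
  interval_cases n <;> norm_num at hlog

lemma clog_two_le {n : ℕ} (hlog : 1 ≤ Real.log n) : (Nat.clog 2 n : ℝ) ≤ 3 * Real.log n := by
  have hpow : (2 : ℝ) ^ (Nat.clog 2 n - 1) ≤ n := by
    exact_mod_cast (Nat.pow_pred_clog_lt_self one_lt_two (two_le_of_one_le_log hlog)).le
  have hmul : (Nat.clog 2 n - 1 : ℕ) * Real.log 2 ≤ Real.log n := by
    rw [← Real.log_pow]
    exact Real.log_le_log (by positivity) hpow
  have hpred : (Nat.clog 2 n : ℝ) ≤ (Nat.clog 2 n - 1 : ℕ) + 1 := by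
    exact_mod_cast Nat.le_add_of_sub_le le_rfl
  nlinarith [Real.log_two_gt_d9, Nat.cast_nonneg (α := ℝ) (Nat.clog 2 n - 1)]

variable {n m t : ℕ} {d μ : ℝ}

/-- The scale of the error, per vertex, in the logarithm of the number of Hamilton cycles of a
graph on `n` vertices satisfying `Mixing G d μ`. -/
noncomputable def errorRate (n : ℕ) (d μ : ℝ) : ℝ :=
  √(μ * Real.log n ^ 2 / d) + Real.log n ^ 2 / n

lemma exists_block_parameters (hlog : 1 ≤ Real.log n) (hn : 72 * Real.log n ≤ n) (hμ : 0 ≤ μ)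
    (hμd : 7296 * (μ * Real.log n ^ 2) ≤ d) :
    ∃ T b : ℕ, n ≤ 2 ^ T ∧ T ≤ 3 * Real.log n ∧ 9 ≤ b ∧ (2 * T + 2) * b ≤ n ∧
      57 * (2 * T + 2 : ℕ) * μ * n ≤ d * b := by
  set T := Nat.clog 2 n
  set M := 2 * T + 2
  have hT : (T : ℝ) ≤ 3 * Real.log n := clog_two_le hlog
  have hM : (M : ℝ) ≤ 8 * Real.log n := by
    push_cast [M]
    linarith
  have hMn : 9 * M ≤ n := by
    have : (9 : ℝ) * M ≤ n := by linarith
    exact_mod_cast this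
  have hMpos : 0 < M := by positivity
  have hnM : (n : ℝ) ≤ 2 * M * (n / M : ℕ) := by
    have hlt : n < M * (n / M) + M := Nat.lt_mul_div_succ n hMpos
    have hle : M ≤ M * (n / M) := Nat.le_mul_of_pos_right M (Nat.div_pos (by omega) hMpos)
    have : n ≤ 2 * (M * (n / M)) := by omega
    rw [mul_assoc]
    exact_mod_cast this
  refine ⟨T, n / M, Nat.le_pow_clog one_lt_two n, hT, (Nat.le_div_iff_mul_le hMpos).2 hMn,
    Nat.mul_div_le n M, ?_⟩
  calc 57 * (M : ℝ) * μ * n ≤ 57 * M * μ * (2 * M * (n / M : ℕ)) := by gcongr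
    _ = 114 * μ * (M : ℝ) ^ 2 * (n / M : ℕ) := by ring
    _ ≤ 114 * μ * (8 * Real.log n) ^ 2 * (n / M : ℕ) := by gcongr
    _ = 7296 * (μ * Real.log n ^ 2) * (n / M : ℕ) := by ring
    _ ≤ d * (n / M : ℕ) := by gcongr

lemma sq_add_one_pow_le_exp_errorRate_pow (hlog : 1 ≤ Real.log n)
    (ht : t ≤ 12 * Real.log n)
    (hm : m ≤ n * √(μ * Real.log n ^ 2 / d) / Real.log n ^ 2 + 1) :
    ((n : ℝ) ^ 2 + 1) ^ ((m + 1) * (2 * t + 5)) ≤ Real.exp (174 * errorRate n d μ) ^ n := by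
  have hn : 2 ≤ n := two_le_of_one_le_log hlog
  have hn₀ : (0 : ℝ) < n := by positivity
  refine pow_le_exp_pow (by positivity) ?_
  have hcube : Real.log ((n : ℝ) ^ 2 + 1) ≤ 3 * Real.log n := by
    rw [← Real.log_rpow hn₀]
    refine Real.log_le_log (by positivity) ?_
    norm_cast
    nlinarith
  set σ := √(μ * Real.log n ^ 2 / d)
  calc (((m + 1) * (2 * t + 5) : ℕ) : ℝ) * Real.log ((n : ℝ) ^ 2 + 1)
      ≤ (n * σ / Real.log n ^ 2 + 2) * (29 * Real.log n) * (3 * Real.log n) := by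
        push_cast
        have hlog₀ : 0 ≤ Real.log ((n : ℝ) ^ 2 + 1) := Real.log_nonneg (by nlinarith)
        gcongr ?_ * ?_ * ?_ <;> linarith
    _ = n * (87 * σ + 174 * (Real.log n ^ 2 / n)) := by field_simp; ring
    _ ≤ n * (174 * errorRate n d μ) := by
        gcongr
        rw [errorRate]
        linarith [Real.sqrt_nonneg (μ * Real.log n ^ 2 / d)]

lemma exists_edge_threshold (hlog : 1 ≤ Real.log n) (hμ : 1 ≤ 2 * μ) (hd : 0 < d)
    (hσ : √(μ * Real.log n ^ 2 / d) ≤ 1 / 2) :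
    ∃ m ≤ n, m ≤ n * √(μ * Real.log n ^ 2 / d) / Real.log n ^ 2 + 1 ∧
      (μ + 1) * n ≤ 3 * √(μ * Real.log n ^ 2 / d) * d * m := by
  have hn : (2 : ℝ) ≤ n := by exact_mod_cast two_le_of_one_le_log hlog
  set L := Real.log n
  set σ := √(μ * L ^ 2 / d)
  have hσ_sq : σ * σ = μ * L ^ 2 / d :=
    Real.mul_self_sqrt (div_nonneg (mul_nonneg (by linarith) (sq_nonneg L)) hd.le)
  obtain ⟨m, hm_ge, hm_le⟩ : ∃ m : ℕ, n * σ / L ^ 2 ≤ m ∧ m ≤ n * σ / L ^ 2 + 1 :=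
    ⟨_, Nat.le_ceil _, (Nat.ceil_lt_add_one (by positivity)).le⟩
  refine ⟨m, ?_, hm_le, ?_⟩
  · have hdiv : n * σ / L ^ 2 ≤ n * σ := div_le_self (by positivity) (one_le_pow₀ hlog)
    have : (m : ℝ) ≤ n := by nlinarith
    exact_mod_cast this
  · calc (μ + 1) * n ≤ 3 * μ * n := by gcongr; linarith
      _ = 3 * (μ * L ^ 2 / d) * d * (n / L ^ 2) := by field_simp
      _ = 3 * σ * d * (n * σ / L ^ 2) := by rw [← hσ_sq]; ring
      _ ≤ 3 * σ * d * m := by gcongr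

lemma two_mul_pow_le_exp_errorRate_pow (hlog : 1 ≤ Real.log n) (hμ : 0 ≤ μ) (hd : 0 < d)
    (hμd : μ * Real.log n ^ 2 ≤ d) {c : ℕ} (hc : c ≤ μ * n / d + 1) :
    ((2 : ℝ) * n) ^ (c + 3) ≤ Real.exp (8 * errorRate n d μ) ^ n := by
  have hn : 2 ≤ n := two_le_of_one_le_log hlog
  have hn₀ : (0 : ℝ) < n := by positivity
  refine pow_le_exp_pow (by positivity) ?_
  have hsq : Real.log (2 * n) ≤ 2 * Real.log n := by
    rw [← Real.log_rpow hn₀]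
    refine Real.log_le_log (by positivity) ?_
    norm_cast
    nlinarith
  set L := Real.log n
  have hL : L ≤ L ^ 2 := le_self_pow₀ hlog two_ne_zero
  have hσ : μ * L ^ 2 / d ≤ √(μ * L ^ 2 / d) :=
    Real.le_sqrt_self_iff.2 ((div_le_one hd).2 hμd)
  calc ((c + 3 : ℕ) : ℝ) * Real.log (2 * n) ≤ (μ * n / d + 4) * (2 * L) := by
        push_cast
        have : 0 ≤ Real.log (2 * (n : ℝ)) := Real.log_nonneg (by norm_cast; omega)
        gcongr ?_ * ?_
        linarith
    _ = 2 * n * (μ * L / d) + 8 * L := by ring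
    _ ≤ 2 * n * (μ * L ^ 2 / d) + 8 * L ^ 2 := by gcongr
    _ ≤ 8 * n * √(μ * L ^ 2 / d) + 8 * L ^ 2 := by gcongr; norm_num
    _ = n * (8 * errorRate n d μ) := by
        rw [errorRate, mul_left_comm, mul_add, mul_div_cancel₀ _ hn₀.ne']
        ring

end ErrorRate

section ExponentialBounds

variable {V : Type*} [DecidableEq V] [Fintype V] {G : SimpleGraph V} [DecidableRel G.Adj]
  {d μ : ℝ}

lemma Mixing.exists_forall_orderings_exists_endsAdj (h : Mixing G d μ)
    (hlog : 1 ≤ Real.log (Fintype.card V)) (hn : 72 * Real.log (Fintype.card V) ≤ Fintype.card V)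
    (hμ : 0 < μ) (hμd : 7296 * (μ * Real.log (Fintype.card V) ^ 2) ≤ d)
    (hdeg : ∀ v, d / 4 ≤ G.degree v) :
    ∃ t : ℕ, t ≤ 12 * Real.log (Fintype.card V) ∧
      ∀ l ∈ orderings V, ∃ l', ModifiedBy G t l l' ∧ EndsAdj G l' := by
  obtain ⟨T, b, hT, hTlog, hb, hbn, hdb⟩ := exists_block_parameters hlog hn hμ.le hμd
  have hd : 0 < d := lt_of_lt_of_le (by positivity) hμd
  refine ⟨4 * T, by push_cast; linarith, fun l hl => ?_⟩
  exact h.exists_endsAdj hμ hd hT le_rfl hb hbn hdb hdeg (mem_orderings.1 hl).1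
    (mem_orderings.1 hl).2

lemma Mixing.mul_exp_neg_errorRate_pow_le (h : Mixing G d μ)
    (hlog : 1 ≤ Real.log (Fintype.card V)) (hn : 72 * Real.log (Fintype.card V) ≤ Fintype.card V)
    (hμ : 1 ≤ 2 * μ) (hdn : d ≤ Fintype.card V)
    (hμd : 7296 * (μ * Real.log (Fintype.card V) ^ 2) ≤ d) (hdeg : ∀ v, d / 4 ≤ G.degree v) :
    (Fintype.card V)! * (d / Fintype.card V) ^ Fintype.card V *
        Real.exp (-(180 * errorRate (Fintype.card V) d μ)) ^ Fintype.card V ≤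
      G.numHamiltonCycles := by
  have hμ₀ : 0 < μ := by linarith
  have hd : 0 < d := lt_of_lt_of_le (by positivity) hμd
  obtain ⟨t, ht, hclose⟩ := h.exists_forall_orderings_exists_endsAdj hlog hn hμ₀ hμd hdeg
  set n := Fintype.card V
  set σ := √(μ * Real.log n ^ 2 / d) with hσ
  set r := errorRate n d μ
  have hn₃ : 3 ≤ n := by
    have : (3 : ℝ) ≤ n := by linarith
    exact_mod_cast this
  have hσ_le : σ ≤ 1 / 85 := by
    rw [hσ, Real.sqrt_le_left (by norm_num), div_le_iff₀ hd]
    linarith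
  obtain ⟨m, hmn, hm_le, hm_ge⟩ :=
    exists_edge_threshold hlog hμ hd (hσ_le.trans (by norm_num))
  have hcount := h.factorial_mul_pow_le_numHamiltonCycles hd.le hdn hn₃ hclose (θ := 3 * σ)
    (by positivity) (by linarith) hm_ge hmn
  push_cast at hcount
  have hrepair : ((n : ℝ) ^ 2 + 1) ^ ((m + 1) * (2 * t + 5)) ≤ Real.exp (174 * r) ^ n :=
    sq_add_one_pow_le_exp_errorRate_pow hlog ht hm_le
  have hgreedy : Real.exp (-(6 * r)) ≤ 1 - 3 * σ := by
    have hσr : σ ≤ r := le_add_of_nonneg_right (by positivity)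
    exact (Real.exp_le_exp.2 (by linarith)).trans
      (exp_neg_two_mul_le_one_sub (by positivity) (by linarith))
  calc (n ! : ℝ) * (d / n) ^ n * Real.exp (-(180 * r)) ^ n
      = n ! * (Real.exp (-(6 * r)) * d / n) ^ n / Real.exp (174 * r) ^ n := by
        rw [show -(180 * r) = -(6 * r) - 174 * r by ring, Real.exp_sub]
        ring
    _ ≤ n ! * ((1 - 3 * σ) * d / n) ^ n / Real.exp (174 * r) ^ n := by gcongr
    _ ≤ G.numHamiltonCycles := by
        rw [div_le_iff₀ (by positivity)]
        exact hcount.trans (by gcongr)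

lemma Mixing.le_mul_exp_errorRate_pow (h : Mixing G d μ)
    (hlog : 1 ≤ Real.log (Fintype.card V)) (hμ : 1 ≤ 2 * μ)
    (hμd : 2 * (μ * Real.log (Fintype.card V) ^ 2) ≤ d) :
    (G.numHamiltonCycles : ℝ) ≤ (Fintype.card V)! * (d / Fintype.card V) ^ Fintype.card V *
      Real.exp (8 * errorRate (Fintype.card V) d μ) ^ Fintype.card V := by
  have hμ₀ : 0 < μ := by linarith
  have hd : 0 < d := lt_of_lt_of_le (by positivity) hμd
  have : Nonempty V := Fintype.card_pos_iff.1 (two_pos.trans_le (two_le_of_one_le_log hlog))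
  set n := Fintype.card V
  have hlog_sq : 1 ≤ Real.log n ^ 2 := one_le_pow₀ hlog
  have hμ_le : 2 * μ ≤ d := by nlinarith
  obtain ⟨c, hc_ge, hc_le, hcn⟩ : ∃ c : ℕ, μ * n / d ≤ c ∧ c ≤ μ * n / d + 1 ∧ c ≤ n :=
    ⟨_, Nat.le_ceil _, (Nat.ceil_lt_add_one (by positivity)).le,
      Nat.ceil_le.2 ((div_le_iff₀ hd).2 (by nlinarith))⟩
  refine (h.numHamiltonCycles_le (by linarith) ((div_le_iff₀ hd).1 hc_ge) hcn).trans ?_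
  gcongr
  exact two_mul_pow_le_exp_errorRate_pow hlog hμ₀.le hd (by linarith) hc_le

end ExponentialBounds

section Spectrum

variable {V : Type*} [DecidableEq V] [Fintype V] {G : SimpleGraph V} [DecidableRel G.Adj]
  {C lam : ℝ}

lemma nonneg_of_nontrivialEigenvaluesLE (h : G.NontrivialEigenvaluesLE lam)
    (hn : 1 < Fintype.card V) : 0 ≤ lam :=
  (abs_nonneg _).trans (h ⟨1, hn⟩ one_ne_zero)

lemma mixing_avgDegree (h : G.NontrivialEigenvaluesLE lam) (hC : 0 ≤ C) (hlam : 0 < lam)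
    (hreg : (G.maxDegree : ℝ) - G.minDegree ≤ C * lam) (hd : (2 + 4 * C) * lam ≤ G.avgDegree) :
    Mixing G G.avgDegree ((1 + 8 * C) * lam) := by
  have hClam : 0 ≤ C * lam := by positivity
  have hpos : 0 < G.avgDegree := by linarith
  have : Nonempty V := not_isEmpty_iff.1 fun _ => by simp [SimpleGraph.avgDegree] at hpos
  convert mixing_of_nontrivialEigenvaluesLE (ε := C * lam) h hlam.le hpos (by linarith)
    (by linarith) fun v => (abs_degree_sub_avgDegree_le v).trans hreg using 1
  ring

end Spectrum

section Asymptotics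

variable {ι : Type*} {l : Filter ι}

lemma exists_tendsto_zero_and_eventually_eq_mul_pow {n : ι → ℕ} {A B η : ι → ℝ}
    (hη : Tendsto η l (𝓝 0)) (hn : ∀ᶠ i in l, n i ≠ 0) (hB : ∀ᶠ i in l, 0 < B i)
    (hlower : ∀ᶠ i in l, B i * Real.exp (-η i) ^ n i ≤ A i)
    (hupper : ∀ᶠ i in l, A i ≤ B i * Real.exp (η i) ^ n i) :
    ∃ ε : ι → ℝ, Tendsto ε l (𝓝 0) ∧ ∀ᶠ i in l, A i = B i * (1 + ε i) ^ n i := by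
  set root : ι → ℝ := fun i => (A i / B i) ^ (n i : ℝ)⁻¹
  have hexp {f : ι → ℝ} (hf : Tendsto f l (𝓝 0)) : Tendsto (fun i => Real.exp (f i)) l (𝓝 1) := by
    simpa using hf.rexp
  have hroot : Tendsto root l (𝓝 1) := by
    refine tendsto_of_tendsto_of_tendsto_of_le_of_le' (hexp (by simpa using hη.neg)) (hexp hη) ?_ ?_
    · filter_upwards [hn, hB, hlower] with i hn hB hlower
      rw [← Real.pow_rpow_inv_natCast (Real.exp_nonneg (-η i)) hn]
      exact Real.rpow_le_rpow (by positivity) ((le_div_iff₀' hB).2 hlower) (by positivity)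
    · filter_upwards [hn, hB, hlower, hupper] with i hn hB hlower hupper
      have hA : 0 ≤ A i := le_trans (by positivity) hlower
      rw [← Real.pow_rpow_inv_natCast (Real.exp_nonneg (η i)) hn]
      exact Real.rpow_le_rpow (by positivity) ((div_le_iff₀' hB).2 hupper) (by positivity)
  refine ⟨fun i => root i - 1, by simpa using hroot.sub_const 1, ?_⟩
  filter_upwards [hn, hB, hlower] with i hn hB hlower
  have hA : 0 ≤ A i := le_trans (by positivity) hlower
  rw [add_sub_cancel, Real.rpow_inv_natCast_pow (by positivity) hn, mul_div_cancel₀ _ hB.ne']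

lemma tendsto_errorRate {n : ι → ℕ} {d μ : ι → ℝ} (hn : Tendsto n l atTop)
    (hμd : Tendsto (fun i => μ i * Real.log (n i) ^ 2 / d i) l (𝓝 0)) :
    Tendsto (fun i => errorRate (n i) (d i) (μ i)) l (𝓝 0) := by
  have hlog : Tendsto (fun i => Real.log (n i) ^ 2 / n i) l (𝓝 0) :=
    (Real.isLittleO_pow_log_id_atTop (n := 2)).tendsto_div_nhds_zero.comp
      (tendsto_natCast_atTop_atTop.comp hn)
  simpa [errorRate] using hμd.sqrt.add hlog

theorem exists_numHamiltonCycles_eq_of_mixing {V : ι → Type*} [∀ i, Fintype (V i)]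
    [∀ i, DecidableEq (V i)] {G : ∀ i, SimpleGraph (V i)} [∀ i, DecidableRel (G i).Adj]
    {d μ : ι → ℝ} (hn : Tendsto (fun i => Fintype.card (V i)) l atTop)
    (hmix : ∀ᶠ i in l, Mixing (G i) (d i) (μ i))
    (hd : ∀ᶠ i in l, 0 < d i) (hdn : ∀ᶠ i in l, d i ≤ Fintype.card (V i))
    (hdeg : ∀ᶠ i in l, ∀ v, d i / 4 ≤ (G i).degree v)
    (hμd : Tendsto (fun i => μ i * Real.log (Fintype.card (V i)) ^ 2 / d i) l (𝓝 0)) :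
    ∃ ε : ι → ℝ, Tendsto ε l (𝓝 0) ∧ ∀ᶠ i in l, ((G i).numHamiltonCycles : ℝ) =
      (Fintype.card (V i))! * (d i / Fintype.card (V i)) ^ Fintype.card (V i) *
        (1 + ε i) ^ Fintype.card (V i) := by
  have hncast : Tendsto (fun i => (Fintype.card (V i) : ℝ)) l atTop :=
    tendsto_natCast_atTop_atTop.comp hn
  have hlog : ∀ᶠ i in l, 1 ≤ Real.log (Fintype.card (V i)) :=
    (Real.tendsto_log_atTop.comp hncast).eventually_ge_atTop 1
  have hlogn : ∀ᶠ i in l, 72 * Real.log (Fintype.card (V i)) ≤ Fintype.card (V i) := by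
    filter_upwards [hncast.eventually (Real.isLittleO_log_id_atTop.bound
      (by norm_num : (0 : ℝ) < 1 / 72)), hlog] with i hi hlog
    rw [Real.norm_of_nonneg (by linarith), id, Real.norm_natCast] at hi
    linarith
  have hsmall : ∀ᶠ i in l, 7296 * (μ i * Real.log (Fintype.card (V i)) ^ 2) ≤ d i := by
    filter_upwards [hμd.eventually_le_const (by norm_num : (0 : ℝ) < 1 / 7296), hd] with i hi hd
    rw [div_le_iff₀ hd] at hi
    linarith
  have hμ : ∀ᶠ i in l, 1 ≤ 2 * μ i := by
    filter_upwards [hmix, hd, hdeg, hn.eventually_gt_atTop 0] with i hmix hd hdeg hn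
    obtain ⟨v⟩ := Fintype.card_pos_iff.1 hn
    refine hmix.one_le_two_mul (u := v) ?_
    have : (0 : ℝ) < (G i).degree v := by linarith [hdeg v]
    exact_mod_cast this
  refine exists_tendsto_zero_and_eventually_eq_mul_pow
    (η := fun i => 180 * errorRate (Fintype.card (V i)) (d i) (μ i))
    (by simpa using (tendsto_errorRate hn hμd).const_mul 180) (hn.eventually_ne_atTop 0) ?_ ?_ ?_
  · filter_upwards [hd, hn.eventually_gt_atTop 0] with i hd hn
    positivity
  · filter_upwards [hmix, hlog, hlogn, hμ, hdn, hsmall, hdeg] with i hmix hlog hlogn hμ hdn hsmall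
      hdeg
    exact hmix.mul_exp_neg_errorRate_pow_le hlog hlogn hμ hdn hsmall hdeg
  · filter_upwards [hmix, hlog, hμ, hsmall, hd] with i hmix hlog hμ hsmall hd
    have hrate : 0 ≤ errorRate (Fintype.card (V i)) (d i) (μ i) := by
      rw [errorRate]
      positivity
    refine (hmix.le_mul_exp_errorRate_pow hlog hμ (by nlinarith)).trans ?_
    gcongr
    norm_num

lemma eventually_pos_and_mul_le_of_log_sq_isLittleO {n : ι → ℕ} {d lam : ι → ℝ}
    (hn : Tendsto n l atTop) (hlam : ∀ᶠ i in l, 0 ≤ lam i) (hd : ∀ᶠ i in l, 0 ≤ d i)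
    (h : (fun i => Real.log (n i) ^ 2) =o[l] fun i => d i / lam i) (K : ℝ) :
    ∀ᶠ i in l, 0 < lam i ∧ K * lam i ≤ d i := by
  have hlog : Tendsto (fun i => ‖Real.log (n i) ^ 2‖) l atTop :=
    tendsto_norm_atTop_atTop.comp <| (tendsto_pow_atTop two_ne_zero).comp <|
      Real.tendsto_log_atTop.comp (tendsto_natCast_atTop_atTop.comp hn)
  have hratio := h.isBigO.trans_tendsto_norm_atTop hlog
  filter_upwards [hlam, hd, hratio.eventually_gt_atTop 0, hratio.eventually_ge_atTop K] with i
    hlam hd hpos hK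
  have hlam₀ : 0 < lam i := hlam.lt_of_ne' fun h₀ => by simp [h₀] at hpos
  rw [Real.norm_of_nonneg (by positivity), le_div_iff₀ hlam₀] at hK
  exact ⟨hlam₀, hK⟩

end Asymptotics

end HamiltonCycleCount

open HamiltonCycleCount

theorem theorem6_general {ι : Type*} {l : Filter ι} {V : ι → Type*} [∀ i, Fintype (V i)]
    [∀ i, DecidableEq (V i)] (G : ∀ i, SimpleGraph (V i)) [∀ i, DecidableRel (G i).Adj]
    (hn : Tendsto (fun i => Fintype.card (V i)) l atTop)
    (lam : ι → ℝ) (hlam : ∀ᶠ i in l, (G i).NontrivialEigenvaluesLE (lam i)) (R : ℝ)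
    (h1 : ∀ᶠ i in l, ((G i).maxDegree : ℝ) - ((G i).minDegree : ℝ) ≤ R * lam i)
    (h2 : (fun i => Real.log (Fintype.card (V i)) ^ 2) =o[l] fun i => (G i).avgDegree / lam i) :
    ∃ ε : ι → ℝ, Tendsto ε l (𝓝 0) ∧ ∀ᶠ i in l, ((G i).numHamiltonCycles : ℝ) =
      (Fintype.card (V i))! * ((G i).avgDegree / Fintype.card (V i)) ^ Fintype.card (V i) *
        (1 + ε i) ^ Fintype.card (V i) := by
  have hlam₀ : ∀ᶠ i in l, 0 ≤ lam i :=
    (hlam.and (hn.eventually_gt_atTop 1)).mono fun i hi =>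
      nonneg_of_nontrivialEigenvaluesLE hi.1 hi.2
  have hreg : ∀ᶠ i in l, ((G i).maxDegree : ℝ) - (G i).minDegree ≤ |R| * lam i :=
    (h1.and hlam₀).mono fun i hi => hi.1.trans (mul_le_mul_of_nonneg_right (le_abs_self R) hi.2)
  have hlarge := eventually_pos_and_mul_le_of_log_sq_isLittleO hn hlam₀
    (.of_forall fun i => avgDegree_nonneg) h2 (2 + 4 * |R|)
  refine exists_numHamiltonCycles_eq_of_mixing (μ := fun i => (1 + 8 * |R|) * lam i) hn ?_ ?_
    (.of_forall fun i => avgDegree_le_card) ?_ ?_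
  · filter_upwards [hlam, hreg, hlarge] with i hlam hreg ⟨hlam₀, hd⟩
    exact mixing_avgDegree hlam (abs_nonneg R) hlam₀ hreg hd
  · filter_upwards [hlarge] with i ⟨hlam₀, hd⟩
    exact lt_of_lt_of_le (by positivity) hd
  · filter_upwards [hreg, hlarge] with i hreg ⟨hlam₀, hd⟩ v
    linarith [(abs_le.1 ((abs_degree_sub_avgDegree_le v).trans hreg)).1]
  · simpa only [div_div_eq_mul_div, mul_div_assoc', mul_zero, mul_assoc, mul_comm (lam _)] using
      h2.tendsto_div_nhds_zero.const_mul (1 + 8 * |R|)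

theorem theorem6
    (n : ℕ → ℕ) (hn : Tendsto n atTop atTop)
    (G : ∀ k, SimpleGraph (Fin (n k))) [∀ k, DecidableRel (G k).Adj]
    (lam : ℕ → ℝ) (hlam : ∀ k, (G k).NontrivialEigenvaluesLE (lam k))
    (R : ℝ) (hR : 0 < R)
    (h1 : ∀ k, ((G k).maxDegree : ℝ) - ((G k).minDegree : ℝ) ≤ R * lam k)
    (h2 : (fun k => Real.log (n k) ^ 2) =o[atTop] fun k => (G k).avgDegree / lam k)
    (h3 : (fun k => Real.log (n k)) =o[atTop]
      fun k => Real.log (G k).avgDegree * Real.log ((G k).avgDegree / lam k)) :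
    ∃ ε : ℕ → ℝ, Tendsto ε atTop (𝓝 0) ∧
      ∀ᶠ k in atTop, ((G k).numHamiltonCycles : ℝ) =
        ((n k)! : ℝ) * ((G k).avgDegree / (n k : ℝ)) ^ (n k) * (1 + ε k) ^ (n k) := by
  simpa only [Fintype.card_fin] using theorem6_general G (by simpa using hn) lam
    (.of_forall hlam) R (.of_forall h1) (by simpa using h2)
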